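/- For each $n\ge 1$ let $m=m(n)$ be a nonnegative integer and let $\boldsymbol p=(p_{11},p_{10},p_{01},p_{00})$ and $\boldsymbol q=(q_{11},q_{10},q_{01},q_{00})$ be probability vectors depending on $n$. The attributed Erdős–Rényi pair $\mathcal G(n,\boldsymbol p;m,\boldsymbol q)$ is a pair of random graphs $(G_1,G_2)$ on $n$ user vertices and $m$ attribute vertices, in which the pairs of edge indicators $(G_1(e),G_2(e))$ are independent over all vertex pairs $e$; $(G_1(e),G_2(e))$ equals $(a,b)\in\{0,1\}^2$ with probability $p_{ab}$ if $e$ is an unordered pair of distinct users, and with probability $q_{ab}$ if $e$ is a user-attribute pair; there are no edges between attributes. Let $\rho_{\mathrm u}$ and $\rho_{\mathrm a}$ be the correlation coefficients of the two indicators for a user-user pair and a user-attribute pair, respectively; it is assumed that $\rho_{\mathrm u}>0$ and $\rho_{\mathrm a}>0$. Let $\Pi^*$ be a uniformly random permutation of the users, independent of $(G_1,G_2)$, and let $G_2'$ be $G_2$ with each user $i$ re-labelled as $\Pi^*(i)$. Exact alignment is achievable w.h.p. if there are estimators $\hat\pi=\hat\pi(G_1,G_2')$ with $\lim_{n\to\infty}\mathsf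 P(\hat\pi(G_1,G_2')\neq\Pi^*)=0$. Assume that $1-(p_{11}+p_{10})=\Theta(1)$, $1-(p_{11}+p_{01})=\Theta(1)$, $\rho_{\mathrm u}=\Theta(1)$, and that $1-(q_{11}+q_{10})=\Theta(1)$, $1-(q_{11}+q_{01})=\Theta(1)$, $\rho_{\mathrm a}=\Theta(1)$. 1. Let $m=\Omega((\log n)^3)$. If $np_{11}+mq_{11}-\log n\to\infty$, then exact alignment is achievable w.h.p. This is tight: if $np_{11}+mq_{11}-\log n\to-\infty$, then exact alignment is not achievable w.h.p. 2. Let $m=o((\log n)^3)$. If $np_{11}+mq_{11}-O(mq_{11}^{3/2})-\log n\to\infty$, then exact alignment is achievable w.h.p. Precisely: for every $\delta>0$ there is a constant $C>0$, depending only on $\delta$, such that if $1-(q_{11}+q_{10})$, $1-(q_{11}+q_{01})$ and $\rho_{\mathrm a}$ are at least $\delta$ for all large $n$ and $np_{11}+mq_{11}-C\,mq_{11}^{3/2}-\log n\to\infty$, then exact alignment is achievable w.h.p. -/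

import Mathlib

open Filter Topology Asymptotics

noncomputable section

namespace AttributedAlignment

/-- The joint law of a pair of edge indicators `(G₁(e), G₂(e))`: `r11` is the probability of
`(1,1)`, `r10` of `(1,0)`, `r01` of `(0,1)` and `r00` of `(0,0)`. -/
structure EdgeLaw where
  r11 : ℝ
  r10 : ℝ
  r01 : ℝ
  r00 : ℝ
  r11_nonneg : 0 ≤ r11
  r10_nonneg : 0 ≤ r10
  r01_nonneg : 0 ≤ r01
  r00_nonneg : 0 ≤ r00
  sum_eq_one : r11 + r10 + r01 + r00 = 1

namespace EdgeLaw

/-- The probability of the outcome `(a, b)`; `true` means that the edge is present. -/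
def prob (L : EdgeLaw) : Bool → Bool → ℝ
  | true, true => L.r11
  | true, false => L.r10
  | false, true => L.r01
  | false, false => L.r00

/-- The probability of an edge in the first graph. -/
def edge₁ (L : EdgeLaw) : ℝ := L.r11 + L.r10

/-- The probability of an edge in the second graph. -/
def edge₂ (L : EdgeLaw) : ℝ := L.r11 + L.r01

/-- The covariance `E[XY] - E[X] E[Y]` of the two edge indicators. -/
def cov (L : EdgeLaw) : ℝ := L.r11 - L.edge₁ * L.edge₂

/-- The variance of the first edge indicator (a Bernoulli variable). -/
def var₁ (L : EdgeLaw) : ℝ := L.edge₁ * (1 - L.edge₁)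

/-- The variance of the second edge indicator (a Bernoulli variable). -/
def var₂ (L : EdgeLaw) : ℝ := L.edge₂ * (1 - L.edge₂)

/-- The correlation coefficient of the two edge indicators. If one of them is almost surely
constant the value is `0`, so `0 < L.corr` includes that both variances are positive. -/
def corr (L : EdgeLaw) : ℝ := L.cov / (√L.var₁ * √L.var₂)

end EdgeLaw

/-- User-user vertex pairs: unordered pairs of distinct users. -/
abbrev UserPair (n : ℕ) : Type := {e : Sym2 (Fin n) // ¬ e.IsDiag}

/-- All vertex pairs that can carry an edge: user-user pairs and user-attribute pairs. -/
abbrev VertexPair (n m : ℕ) : Type := UserPair n ⊕ (Fin n × Fin m)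

/-- An attributed graph on `n` users and `m` attributes, given by its edge indicators. -/
abbrev AttrGraph (n m : ℕ) : Type := VertexPair n m → Bool

/-- The action of a permutation of the users on vertex pairs; attributes are fixed. -/
def movePair {n m : ℕ} (π : Equiv.Perm (Fin n)) : VertexPair n m → VertexPair n m
  | Sum.inl e => Sum.inl ⟨e.1.map π, fun h => e.2 ((Sym2.isDiag_map π.injective).1 h)⟩
  | Sum.inr iv => Sum.inr (π iv.1, iv.2)

/-- The graph obtained from `g` by re-labelling each user `i` as `π i`, that is,
`(relabel π g) (π e) = g e` for every vertex pair `e`. -/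
def relabel {n m : ℕ} (π : Equiv.Perm (Fin n)) (g : AttrGraph n m) : AttrGraph n m :=
  fun e => g (movePair π⁻¹ e)

/-- The law of the pair of edge indicators at a vertex pair: `p` for user-user pairs and `q` for
user-attribute pairs. -/
def pairLaw {n m : ℕ} (p q : EdgeLaw) : VertexPair n m → EdgeLaw
  | Sum.inl _ => p
  | Sum.inr _ => q

/-- The probability `P((G₁, G₂) = (g₁, g₂))` in the attributed Erdős–Rényi pair
`𝒢(n, p; m, q)`: the pairs `(G₁(e), G₂(e))` are independent over the vertex pairs `e`. -/
def jointProb {n m : ℕ} (p q : EdgeLaw) (g₁ g₂ : AttrGraph n m) : ℝ :=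
  ∏ e : VertexPair n m, (pairLaw p q e).prob (g₁ e) (g₂ e)

/-- An estimator of the permutation of the users from the observable pair `(G₁, G₂')`. -/
abbrev Estimator (n m : ℕ) : Type := AttrGraph n m → AttrGraph n m → Equiv.Perm (Fin n)

/-- The probability of error `P(est (G₁, G₂') ≠ Π*)`, where `(G₁, G₂) ∼ 𝒢(n, p; m, q)`, the
permutation `Π*` is uniform on the permutations of the users and independent of `(G₁, G₂)`, and
`G₂'` is `G₂` re-labelled by `Π*`. -/
def errorProb {n m : ℕ} (p q : EdgeLaw) (est : Estimator n m) : ℝ :=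
  ∑ π : Equiv.Perm (Fin n), ∑ g₁ : AttrGraph n m, ∑ g₂ : AttrGraph n m,
    ((n.factorial : ℝ)⁻¹ * jointProb p q g₁ g₂) *
      (if est g₁ (relabel π g₂) = π then 0 else 1)

/-- Exact alignment is achievable with high probability for the sequence of models
`𝒢(n, p n; m n, q n)`, `n → ∞`. -/
def ExactAlignmentAchievable (m : ℕ → ℕ) (p q : ℕ → EdgeLaw) : Prop :=
  ∃ est : ∀ n : ℕ, Estimator n (m n),
    Tendsto (fun n => errorProb (p n) (q n) (est n)) atTop (𝓝 0)

/-- The edge indicators of the two graphs are positively correlated, for every model of the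
sequence. -/
def PositivelyCorrelated (p : ℕ → EdgeLaw) : Prop := ∀ n, 0 < (p n).corr

/-- The marginal non-edge probabilities in both graphs and the correlation coefficient
are `Θ(1)`. -/
def NonEdgeAndCorrTheta (p : ℕ → EdgeLaw) : Prop :=
  (fun n => 1 - (p n).edge₁) =Θ[atTop] (fun _ => (1 : ℝ)) ∧
  (fun n => 1 - (p n).edge₂) =Θ[atTop] (fun _ => (1 : ℝ)) ∧
  (fun n => (p n).corr) =Θ[atTop] (fun _ => (1 : ℝ))

/-- The same condition with an explicit constant: for all large `n` both marginal non-edge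
probabilities and the correlation coefficient are at least `δ`. (They are at most `1` anyway.) -/
def NonEdgeAndCorrAtLeast (δ : ℝ) (p : ℕ → EdgeLaw) : Prop :=
  ∀ᶠ n in atTop, δ ≤ 1 - (p n).edge₁ ∧ δ ≤ 1 - (p n).edge₂ ∧ δ ≤ (p n).corr

end AttributedAlignment

end

open AttributedAlignment

/-!
Write `J g₁ g₂` for the likelihood of a graph pair. Both directions reduce to the event `HasRival`
that some non-trivial re-labelling `τ` of the second graph satisfies `J g₁ (τ g₂) ≥ J g₁ g₂`. The
maximum likelihood estimator errs only on this event, and every estimator errs with probability at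
least `P(HasRival) - 1/2`, because of two such competitors it names at most one
(`exists_estimator_errorProb_le`, `eventProb_hasRival_le_errorProb_add`).

*Achievability.* For a fixed `τ`, the probability that it is a rival is at most
`∑ √(J g₁ g₂ * J g₁ (τ g₂))`. This sum is a product over the cycles of `τ` on vertex pairs of traces
of powers of a `2 × 2` matrix, and rather than computed it is bounded by Frobenius norms, one
factor per moved pair (`sum_prod_perm_le`). A moved pair contributes `exp (-gap)` with
`gap = (√(r11 r00) - √(r10 r01))²`, which under the hypotheses is at least `c * r11` and
`r11 - O(r11 ^ (3/2))`. If `τ` moves `k` users, about `k (n - k/2)` user pairs and exactly `k m`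
attribute pairs move (at most `k` user pairs are exchanged rather than moved), while there are at
most `n ^ k` such `τ`. With `x = n * p11` there are three regimes.

* If `x ≥ K log n`, the union bound over `τ` works with the crude gap `c * p11`.
* If `x < K log n` and `k x ≤ 300 n`, the loss from `k / 2` in `k (n - k/2)` is `O(k)`, so the terms
  sum to a geometric series in `exp (O(1) - t)`, where `t = x + m * gap q - log n` diverges.
* If `x < K log n` and `k x > 300 n`, the union bound fails as it stands: the deficit `k x / n` per
  moved user need not be bounded. But the number of sets of `k` users is only
  `(e n / k) ^ k ≤ (e x) ^ k`, so by Chernoff's bound every such set sees at least `k x / 16` edges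
  common to both graphs. On this event the overlap can be weighted by `n ^ (1/4)` for each common
  edge at a moved user, and then beats `n ^ k` by far
  (`exp_mul_sum_sqrt_jointProb_le`, `sum_eventProb_hits_lt_le`).

Finally `m * gap q` is at least `m * q11 - O(m * q11 ^ (3/2))`, and the error term is harmless if `m`
is at least of order `(log n)³` (`tendsto_gap_of_log_pow_isBigO`).

*Converse.* Two users without any edge common to both graphs can be exchanged without loss of
likelihood, since the indicators are positively correlated (`hasRival_of_isolated`). The expected
number of such users is about `exp (log n - n * p11 - m * q11)`, which diverges, and the second
moment method produces two of them (`eventProb_hasRival_ge`).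
-/

namespace AttributedAlignment

/-! ### Products of kernels along a permutation -/

section PermProduct

variable {ι : Type} [Fintype ι]

theorem sq_sum_mul_le_frobenius (A B : ι → ι → ℝ) :
    (∑ x, ∑ y, A x y * B y x) ^ 2 ≤ (∑ x, ∑ y, A x y ^ 2) * ∑ x, ∑ y, B x y ^ 2 := by
  have h := Finset.sum_mul_sq_le_sq_mul_sq (Finset.univ : Finset (ι × ι))
    (fun z => A z.1 z.2) (fun z => B z.2 z.1)
  simp only [Fintype.sum_prod_type] at h
  rwa [Finset.sum_comm (f := fun x y => B y x ^ 2)] at h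

theorem frobenius_mul_le (A B : ι → ι → ℝ) :
    ∑ x, ∑ y, (∑ z, A x z * B z y) ^ 2 ≤ (∑ x, ∑ y, A x y ^ 2) * ∑ x, ∑ y, B x y ^ 2 := by
  calc ∑ x, ∑ y, (∑ z, A x z * B z y) ^ 2
      ≤ ∑ x, ∑ y, (∑ z, A x z ^ 2) * ∑ z, B z y ^ 2 :=
        Finset.sum_le_sum fun x _ => Finset.sum_le_sum fun y _ =>
          Finset.sum_mul_sq_le_sq_mul_sq _ _ _
    _ = _ := by
        simp_rw [← Finset.mul_sum, ← Finset.sum_mul]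
        rw [Finset.sum_comm (f := fun x y => B x y ^ 2)]

/-- A cyclic product of non-negative kernels along a permutation `σ` is bounded by the product of
their Frobenius norms, where a fixed point contributes its trace. The proof removes one variable
at a time: summing it out composes its kernel with the kernel of its predecessor, and the
Frobenius norm is submultiplicative and bounds the trace of a product. -/
theorem sum_prod_perm_le {α : Type} [Fintype α] [DecidableEq α] (σ : Equiv.Perm α)
    (N : α → ι → ι → ℝ) (b : α → ℝ) (hN : ∀ e y z, 0 ≤ N e y z) (hb : ∀ e, 0 ≤ b e)
    (hmoved : ∀ e, σ e ≠ e → ∑ y, ∑ z, N e y z ^ 2 ≤ b e ^ 2)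
    (hfixed : ∀ e, σ e = e → ∑ y, N e y y ≤ b e) :
    ∑ x : α → ι, ∏ e, N e (x e) (x (σ e)) ≤ ∏ e, b e := by
  classical
  refine Fintype.induction_empty_option (P := fun α [Fintype α] => ∀ (d : DecidableEq α)
    (σ : Equiv.Perm α) (N : α → ι → ι → ℝ) (b : α → ℝ), (∀ e y z, 0 ≤ N e y z) →
    (∀ e, 0 ≤ b e) → (∀ e, σ e ≠ e → ∑ y, ∑ z, N e y z ^ 2 ≤ b e ^ 2) →
    (∀ e, σ e = e → ∑ y, N e y y ≤ b e) →
    ∑ x : α → ι, ∏ e, N e (x e) (x (σ e)) ≤ ∏ e, b e) ?_ ?_ ?_ α inferInstance σ N b hN hb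
    hmoved hfixed
  · intro α β _ f ih d σ N b hN hb hm hf
    let _ : Fintype α := Fintype.ofEquiv β f.symm
    have key := ih (Classical.decEq α) (f.trans (σ.trans f.symm)) (fun e => N (f e)) (fun e => b (f e))
      (fun e => hN _) (fun e => hb _) (fun e he => hm _ fun h => he (by simp [h]))
      (fun e he => hf _ (by simpa [Equiv.symm_apply_eq] using he))
    rw [Equiv.prod_comp f b] at key
    refine le_trans (le_of_eq ?_) key
    refine Fintype.sum_equiv (Equiv.arrowCongr f.symm (Equiv.refl ι)) _ _ fun x => ?_
    rw [← Equiv.prod_comp f]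
    simp
  · intro d σ N b _ _ _ _
    simp
  · intro α _ ih d σ N b hN hb hm hf
    let d' : DecidableEq α := Classical.decEq α
    obtain rfl : d = Option.instDecidableEq := Subsingleton.elim _ _
    obtain ⟨⟨i, τ⟩, rfl⟩ := Equiv.Perm.decomposeOption.symm.surjective σ
    have hsum : ∀ F : (Option α → ι) → ℝ, ∑ x, F x
        = ∑ x : α → ι, ∑ y : ι, F (fun o => o.elim y x) := by
      intro F
      rw [← Equiv.sum_comp (Equiv.piOptionEquivProd (β := fun _ : Option α => ι)).symm,
        Fintype.sum_prod_type, Finset.sum_comm]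
      refine Finset.sum_congr rfl fun x _ => Finset.sum_congr rfl fun y _ => ?_
      congr 1
      funext o
      cases o <;> rfl
    rw [hsum, Fintype.prod_option]
    simp_rw [Fintype.prod_option]
    rcases i with _ | a
    · have e0 : (Equiv.Perm.decomposeOption.symm (none, τ)) none = none := by simp
      have e1 : ∀ c, (Equiv.Perm.decomposeOption.symm (none, τ)) (some c) = some (τ c) := by
        intro c; simp
      simp only [e0, e1, Option.elim]
      simp_rw [← Finset.sum_mul]
      rw [← Finset.mul_sum]
      refine mul_le_mul (hf none e0) ?_ (Finset.sum_nonneg fun x _ =>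
        Finset.prod_nonneg fun e _ => hN _ _ _) (hb _)
      refine ih d' τ (fun c => N (some c)) (fun c => b (some c)) (fun _ => hN _) (fun _ => hb _)
        (fun c hc => hm _ ?_) (fun c hc => hf _ ?_)
      · rw [e1]; simpa using hc
      · rw [e1, hc]
    · have e0 : (Equiv.Perm.decomposeOption.symm (some a, τ)) none = some a := by simp
      have e1 : ∀ c, (Equiv.Perm.decomposeOption.symm (some a, τ)) (some c)
          = if τ c = a then none else some (τ c) := by
        intro c
        simp only [Equiv.Perm.decomposeOption_symm_apply, Equiv.Perm.coe_mul, Function.comp_apply,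
          Equiv.optionCongr_apply, Option.map_some]
        split_ifs with h
        · rw [h, Equiv.swap_apply_right]
        · exact Equiv.swap_apply_of_ne_of_ne (by simp) (by simpa using h)
      -- the predecessor of the eliminated variable in its cycle
      set c₀ := τ.symm a with hc₀
      have hτ : τ c₀ = a := by simp [hc₀]
      have hτ' : ∀ c, c ≠ c₀ → τ c ≠ a := fun c hc h => hc (by rw [hc₀, ← h]; simp)
      have hmn := hm none (by rw [e0]; simp)
      have hmc := hm (some c₀) (by rw [e1, if_pos hτ]; simp)
      -- the kernel at `c₀` after summation over the eliminated variable
      let N' : α → ι → ι → ℝ := Function.update (fun c => N (some c)) c₀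
        fun y z => ∑ w, N (some c₀) y w * N none w z
      let b' : α → ℝ := Function.update (fun c => b (some c)) c₀ (b (some c₀) * b none)
      have hN'₀ : N' c₀ = fun y z => ∑ w, N (some c₀) y w * N none w z := Function.update_self ..
      have hN'₁ : ∀ c, c ≠ c₀ → N' c = N (some c) := fun c hc => Function.update_of_ne hc ..
      have hb'₀ : b' c₀ = b (some c₀) * b none := Function.update_self ..
      have hb'₁ : ∀ c, c ≠ c₀ → b' c = b (some c) := fun c hc => Function.update_of_ne hc ..
      have key := ih d' τ N' b' ?_ ?_ ?_ ?_
      · refine le_trans (le_of_eq ?_) (key.trans (le_of_eq ?_))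
        · refine Finset.sum_congr rfl fun x _ => ?_
          rw [← Finset.mul_prod_erase _ _ (Finset.mem_univ c₀), hN'₀, Finset.sum_mul]
          refine Finset.sum_congr rfl fun y _ => ?_
          rw [← Finset.mul_prod_erase _ _ (Finset.mem_univ c₀), ← mul_assoc, e0, e1, if_pos hτ, hτ]
          simp only [Option.elim]
          congr 1
          · ring
          · refine Finset.prod_congr rfl fun c hc => ?_
            have hc' := Finset.ne_of_mem_erase hc
            rw [e1, if_neg (hτ' c hc'), hN'₁ c hc']
        · rw [← Finset.mul_prod_erase _ _ (Finset.mem_univ c₀),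
            ← Finset.mul_prod_erase _ (fun c => b (some c)) (Finset.mem_univ c₀), hb'₀,
            Finset.prod_congr rfl fun c hc => hb'₁ c (Finset.ne_of_mem_erase hc)]
          ring
      · intro e y z
        by_cases h : e = c₀
        · subst h; rw [hN'₀]
          exact Finset.sum_nonneg fun w _ => mul_nonneg (hN _ _ _) (hN _ _ _)
        · rw [hN'₁ e h]; exact hN _ _ _
      · intro e
        by_cases h : e = c₀
        · rw [h, hb'₀]; exact mul_nonneg (hb _) (hb _)
        · rw [hb'₁ e h]; exact hb _
      · intro e he
        by_cases h : e = c₀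
        · rw [h, hb'₀, hN'₀, mul_pow]
          exact (frobenius_mul_le _ _).trans (mul_le_mul hmc hmn
            (Finset.sum_nonneg fun x _ => Finset.sum_nonneg fun y _ => sq_nonneg _) (sq_nonneg _))
        · rw [hN'₁ e h, hb'₁ e h]
          refine hm _ ?_
          rw [e1, if_neg (hτ' e h)]; simpa using he
      · intro e he
        by_cases h : e = c₀
        · rw [h, hb'₀, hN'₀]
          refine abs_le_of_sq_le_sq' ?_ (mul_nonneg (hb _) (hb _)) |>.2
          rw [mul_pow]
          exact (sq_sum_mul_le_frobenius _ _).trans (mul_le_mul hmc hmn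
            (Finset.sum_nonneg fun x _ => Finset.sum_nonneg fun y _ => sq_nonneg _) (sq_nonneg _))
        · rw [hN'₁ e h, hb'₁ e h]
          refine hf _ ?_
          rw [e1, if_neg (hτ' e h), he]

end PermProduct

/-- A sum over pairs of indicator vectors of a product over coordinates factorizes. -/
theorem sum_sum_prod_eq {E : Type} [Fintype E] [DecidableEq E] (F : E → Bool → Bool → ℝ) :
    ∑ g₁ : E → Bool, ∑ g₂ : E → Bool, ∏ e, F e (g₁ e) (g₂ e) = ∏ e, ∑ a, ∑ b, F e a b := by
  have h : ∀ g₁ : E → Bool, ∑ g₂ : E → Bool, ∏ e, F e (g₁ e) (g₂ e)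
      = ∏ e, ∑ b, F e (g₁ e) b := fun g₁ => by
    rw [Finset.prod_univ_sum, Fintype.piFinset_univ]
  simp_rw [h]
  rw [Finset.prod_univ_sum, Fintype.piFinset_univ]

/-! ### Single edge laws -/

namespace EdgeLaw

variable (L : EdgeLaw)

theorem prob_nonneg (a b : Bool) : 0 ≤ L.prob a b := by
  cases a <;> cases b
  exacts [L.r00_nonneg, L.r01_nonneg, L.r10_nonneg, L.r11_nonneg]

theorem sum_prob : ∑ a, ∑ b, L.prob a b = 1 := by
  simp only [Fintype.sum_bool, prob]
  linarith [L.sum_eq_one]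

theorem r11_le_one : L.r11 ≤ 1 := by
  linarith [L.sum_eq_one, L.r10_nonneg, L.r01_nonneg, L.r00_nonneg]

theorem cov_eq : L.cov = L.r11 * L.r00 - L.r10 * L.r01 := by
  have h : L.r00 = 1 - L.r11 - L.r10 - L.r01 := by linarith [L.sum_eq_one]
  rw [cov, edge₁, edge₂, h]; ring

/-- The square of the determinant of the matrix `(√P(a,b))`. Its double is the loss of the
Bhattacharyya overlap between a pair of edges and the same pair with the second indicators
exchanged. -/
noncomputable def gap : ℝ := (√(L.r11 * L.r00) - √(L.r10 * L.r01)) ^ 2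

theorem gap_nonneg : 0 ≤ L.gap := sq_nonneg _

/-- The kernel that couples the second indicators `y` at an edge and `y'` at its image when the
likelihoods of a graph pair and of its re-labelling are combined in a geometric mean: the first
indicator is summed out, and the outcome `(1,1)` of the unmoved pair carries the weight `z`. -/
noncomputable def overlap (z : ℝ) (y y' : Bool) : ℝ :=
  ∑ a, (if a && y then z else 1) * (√(L.prob a y) * √(L.prob a y'))

theorem overlap_nonneg {z : ℝ} (hz : 0 ≤ z) (y y' : Bool) : 0 ≤ L.overlap z y y' := by
  refine Finset.sum_nonneg fun a _ => mul_nonneg ?_ (by positivity)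
  split_ifs
  exacts [hz, zero_le_one]

theorem sum_overlap_diag (z : ℝ) : ∑ y, L.overlap z y y = 1 + (z - 1) * L.r11 := by
  simp only [overlap, Fintype.sum_bool, prob, Bool.and_self, Bool.and_false, Bool.false_and,
    if_true, Bool.false_eq_true, if_false,
    Real.mul_self_sqrt L.r11_nonneg, Real.mul_self_sqrt L.r10_nonneg,
    Real.mul_self_sqrt L.r01_nonneg, Real.mul_self_sqrt L.r00_nonneg]
  linarith [L.sum_eq_one]

theorem sum_overlap_one_sq : ∑ y, ∑ y', L.overlap 1 y y' ^ 2 = 1 - 2 * L.gap := by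
  have h11 := Real.sq_sqrt L.r11_nonneg
  have h10 := Real.sq_sqrt L.r10_nonneg
  have h01 := Real.sq_sqrt L.r01_nonneg
  have h00 := Real.sq_sqrt L.r00_nonneg
  have hs := L.sum_eq_one
  rw [gap, Real.sqrt_mul L.r11_nonneg, Real.sqrt_mul L.r10_nonneg]
  simp only [overlap, Fintype.sum_bool, prob, ite_self, one_mul]
  rw [← h11, ← h10, ← h01, ← h00] at hs
  generalize √L.r11 = a at *
  generalize √L.r10 = b at *
  generalize √L.r01 = c at *
  generalize √L.r00 = d at *
  have : (1 : ℝ) = (a ^ 2 + b ^ 2 + c ^ 2 + d ^ 2) ^ 2 := by rw [hs]; norm_num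
  rw [this]; ring

theorem sum_overlap_one_sq_le : ∑ y, ∑ y', L.overlap 1 y y' ^ 2 ≤ Real.exp (-L.gap) ^ 2 := by
  rw [sum_overlap_one_sq, ← Real.exp_nat_mul]
  have := Real.add_one_le_exp ((2 : ℕ) * -L.gap)
  push_cast at this ⊢
  linarith

/-- Both non-edge probabilities and the correlation coefficient are at least `δ`. -/
def AtLeast (δ : ℝ) : Prop := δ ≤ 1 - L.edge₁ ∧ δ ≤ 1 - L.edge₂ ∧ δ ≤ L.corr

variable {L}

theorem cov_pos_of_corr_pos (h : 0 < L.corr) : 0 < L.cov := by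
  by_contra! hc
  exact absurd h (not_lt.2 (div_nonpos_of_nonpos_of_nonneg hc (by positivity)))

theorem r11_pos_of_corr_pos (h : 0 < L.corr) : 0 < L.r11 := by
  have := cov_pos_of_corr_pos h
  rw [cov_eq] at this
  have h1 : 0 < L.r11 * L.r00 := by nlinarith [mul_nonneg L.r10_nonneg L.r01_nonneg]
  exact pos_of_mul_pos_left h1 L.r00_nonneg

theorem AtLeast.sq_cov_ge {δ : ℝ} (hδ : 0 < δ) (h : L.AtLeast δ) :
    δ ^ 4 * (L.edge₁ * L.edge₂) ≤ L.cov ^ 2 := by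
  obtain ⟨h1, h2, h3⟩ := h
  have e1 : 0 ≤ L.edge₁ := add_nonneg L.r11_nonneg L.r10_nonneg
  have e2 : 0 ≤ L.edge₂ := add_nonneg L.r11_nonneg L.r01_nonneg
  have v1 : δ * L.edge₁ ≤ L.var₁ := by rw [var₁]; nlinarith
  have v2 : δ * L.edge₂ ≤ L.var₂ := by rw [var₂]; nlinarith
  have v1' : 0 ≤ L.var₁ := le_trans (by positivity) v1
  have v2' : 0 ≤ L.var₂ := le_trans (by positivity) v2
  have hpos : 0 < √L.var₁ * √L.var₂ := by
    refine lt_of_le_of_ne (by positivity) fun h0 => ?_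
    rw [corr, ← h0, div_zero] at h3
    linarith
  rw [corr, le_div_iff₀ hpos] at h3
  calc δ ^ 4 * (L.edge₁ * L.edge₂) = δ ^ 2 * ((δ * L.edge₁) * (δ * L.edge₂)) := by ring
    _ ≤ δ ^ 2 * (L.var₁ * L.var₂) := by gcongr
    _ = (δ * (√L.var₁ * √L.var₂)) ^ 2 := by
        rw [mul_pow, mul_pow, Real.sq_sqrt v1', Real.sq_sqrt v2']
    _ ≤ L.cov ^ 2 := by gcongr

/-- For indicators with correlation bounded away from `0`, both edge probabilities are of the order
of the probability of a common edge. -/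
theorem AtLeast.edge_le {δ : ℝ} (hδ : 0 < δ) (h : L.AtLeast δ) :
    L.edge₁ ≤ (δ ^ 4)⁻¹ * L.r11 ∧ L.edge₂ ≤ (δ ^ 4)⁻¹ * L.r11 := by
  have hr : 0 < L.r11 := r11_pos_of_corr_pos (hδ.trans_le h.2.2)
  have hc := cov_pos_of_corr_pos (hδ.trans_le h.2.2)
  have h1 : L.r11 ≤ L.edge₁ := by simp [edge₁, L.r10_nonneg]
  have h2 : L.r11 ≤ L.edge₂ := by simp [edge₂, L.r01_nonneg]
  have hcr : L.cov ≤ L.r11 := by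
    rw [cov]; nlinarith [mul_nonneg (hr.le.trans h1) (hr.le.trans h2)]
  have hsq := (h.sq_cov_ge hδ).trans (pow_le_pow_left₀ hc.le hcr 2)
  have hδ4 : 0 < δ ^ 4 := by positivity
  constructor
  · rw [← div_eq_inv_mul, le_div_iff₀ hδ4]
    refine le_of_mul_le_mul_right ?_ hr
    nlinarith [mul_le_mul_of_nonneg_left h2 (mul_nonneg hδ4.le (hr.le.trans h1))]
  · rw [← div_eq_inv_mul, le_div_iff₀ hδ4]
    refine le_of_mul_le_mul_right ?_ hr
    nlinarith [mul_le_mul_of_nonneg_left h1 (mul_nonneg hδ4.le (hr.le.trans h2))]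

theorem AtLeast.gap_ge {δ : ℝ} (hδ : 0 < δ) (h : L.AtLeast δ) : δ ^ 4 / 4 * L.r11 ≤ L.gap := by
  have hr : 0 < L.r11 := r11_pos_of_corr_pos (hδ.trans_le h.2.2)
  have hc := cov_pos_of_corr_pos (hδ.trans_le h.2.2)
  have h1 : L.r11 ≤ L.edge₁ := by simp [edge₁, L.r10_nonneg]
  have h2 : L.r11 ≤ L.edge₂ := by simp [edge₂, L.r01_nonneg]
  have he1 := hr.le.trans h1
  have hsq : δ ^ 4 * (L.r11 * L.r11) ≤ L.cov ^ 2 :=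
    le_trans (by gcongr) (h.sq_cov_ge hδ)
  have hce := L.cov_eq
  have ha : 0 ≤ L.r11 * L.r00 := mul_nonneg L.r11_nonneg L.r00_nonneg
  have hb : 0 ≤ L.r10 * L.r01 := mul_nonneg L.r10_nonneg L.r01_nonneg
  have hab : √(L.r10 * L.r01) ≤ √(L.r11 * L.r00) := Real.sqrt_le_sqrt (by linarith)
  have hfac : L.cov ^ 2 = L.gap * (√(L.r11 * L.r00) + √(L.r10 * L.r01)) ^ 2 := by
    rw [gap, ← mul_pow, hce, mul_comm (_ - _), ← sq_sub_sq, Real.sq_sqrt ha, Real.sq_sqrt hb]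
  have hsum : (√(L.r11 * L.r00) + √(L.r10 * L.r01)) ^ 2 ≤ 4 * L.r11 := by
    calc (√(L.r11 * L.r00) + √(L.r10 * L.r01)) ^ 2
        ≤ (√(L.r11 * L.r00) + √(L.r11 * L.r00)) ^ 2 := by gcongr
      _ = 4 * (L.r11 * L.r00) := by rw [← two_mul, mul_pow, Real.sq_sqrt ha]; norm_num
      _ ≤ 4 * L.r11 := by
          nlinarith [L.sum_eq_one, L.r11_nonneg, L.r10_nonneg, L.r01_nonneg]
  have h4 : δ ^ 4 * (L.r11 * L.r11) ≤ L.gap * (4 * L.r11) := by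
    rw [hfac] at hsq
    exact hsq.trans (mul_le_mul_of_nonneg_left hsum L.gap_nonneg)
  nlinarith

theorem AtLeast.gap_ge_sub {δ : ℝ} (hδ : 0 < δ) (h : L.AtLeast δ) :
    L.r11 - (1 + 4 * (δ ^ 4)⁻¹) * (L.r11 * √L.r11) ≤ L.gap := by
  obtain ⟨h1, h2⟩ := h.edge_le hδ
  have hr := L.r11_nonneg
  set K := (δ ^ 4)⁻¹ with hK
  have hK0 : 0 < K := by positivity
  have h10 : L.r10 ≤ K * L.r11 := by rw [edge₁] at h1; linarith
  have h01 : L.r01 ≤ K * L.r11 := by rw [edge₂] at h2; linarith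
  have hp10 := L.r10_nonneg
  have hp01 := L.r01_nonneg
  have hp00 := L.r00_nonneg
  have h00 : 1 - (1 + 2 * K) * L.r11 ≤ L.r00 := by linarith [L.sum_eq_one]
  have h00' : L.r00 ≤ 1 := by linarith [L.sum_eq_one]
  have ha : 0 ≤ L.r11 * L.r00 := mul_nonneg hr hp00
  have hb : 0 ≤ L.r10 * L.r01 := mul_nonneg hp10 hp01
  have hx : √(L.r11 * L.r00) ≤ √L.r11 := Real.sqrt_le_sqrt (by nlinarith)
  have hy : √(L.r10 * L.r01) ≤ K * L.r11 := by
    rw [Real.sqrt_le_left (by positivity)]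
    nlinarith [mul_le_mul h10 h01 hp01 (by positivity)]
  have hxy : √(L.r11 * L.r00) * √(L.r10 * L.r01) ≤ √L.r11 * (K * L.r11) := by gcongr
  have hs1 : L.r11 ≤ √L.r11 := by
    rw [Real.le_sqrt hr hr]; nlinarith [L.r11_le_one]
  have hgap : L.gap = L.r11 * L.r00 + L.r10 * L.r01
      - 2 * (√(L.r11 * L.r00) * √(L.r10 * L.r01)) := by
    rw [gap, sub_sq, Real.sq_sqrt ha, Real.sq_sqrt hb]; ring
  have h5 : L.r11 * (1 - (1 + 2 * K) * L.r11) ≤ L.r11 * L.r00 := by gcongr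
  have h6 : (1 + 2 * K) * (L.r11 * L.r11) ≤ (1 + 2 * K) * (L.r11 * √L.r11) := by gcongr
  rw [hgap]
  nlinarith

/-- With a weight `z` as large as `r11 ^ (-1/2)`, the weighted overlap still has Frobenius norm
`1 + O(r11)`. -/
theorem AtLeast.sum_overlap_sq_le {δ : ℝ} (hδ : 0 < δ) (h : L.AtLeast δ) {z : ℝ} (hz : 1 ≤ z)
    (hzr : z ^ 2 * L.r11 ≤ 1) :
    ∑ y, ∑ y', L.overlap z y y' ^ 2 ≤ Real.exp (5 * (1 + (δ ^ 4)⁻¹) ^ 2 * L.r11) ^ 2 := by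
  obtain ⟨h1, h2⟩ := h.edge_le hδ
  have hr := L.r11_nonneg
  set K := (δ ^ 4)⁻¹ with hK
  have hK0 : 0 < K := by positivity
  have h10 : L.r10 ≤ K * L.r11 := by rw [edge₁] at h1; linarith
  have h01 : L.r01 ≤ K * L.r11 := by rw [edge₂] at h2; linarith
  have hp10 := L.r10_nonneg
  have hp01 := L.r01_nonneg
  have hp00 := L.r00_nonneg
  have hs := L.sum_eq_one
  have h00' : L.r00 ≤ 1 := by linarith
  have s11 := Real.sq_sqrt hr
  have s10 := Real.sq_sqrt hp10
  have s01 := Real.sq_sqrt hp01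
  have s00 := Real.sq_sqrt hp00
  have hz2 : z ^ 2 * L.r11 ^ 2 ≤ L.r11 := by nlinarith
  have e1 : (z * L.r11 + L.r01) ^ 2 ≤ (1 + K) ^ 2 * L.r11 := by
    have : z * L.r11 + L.r01 ≤ (1 + K) * (z * L.r11) := by nlinarith
    calc (z * L.r11 + L.r01) ^ 2 ≤ ((1 + K) * (z * L.r11)) ^ 2 := by gcongr
      _ = (1 + K) ^ 2 * (z ^ 2 * L.r11 ^ 2) := by ring
      _ ≤ _ := by gcongr
  have hzK : z ^ 2 * (L.r11 * (K * L.r11)) ≤ K * L.r11 := by nlinarith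
  have e2 : (z * (√L.r11 * √L.r10) + √L.r01 * √L.r00) ^ 2 ≤ 4 * K * L.r11 := by
    calc (z * (√L.r11 * √L.r10) + √L.r01 * √L.r00) ^ 2
        ≤ 2 * ((z * (√L.r11 * √L.r10)) ^ 2 + (√L.r01 * √L.r00) ^ 2) := add_sq_le
      _ = 2 * (z ^ 2 * (L.r11 * L.r10) + L.r01 * L.r00) := by
          rw [mul_pow, mul_pow, mul_pow, s11, s10, s01, s00]
      _ ≤ 2 * (z ^ 2 * (L.r11 * (K * L.r11)) + K * L.r11 * 1) := by gcongr
      _ ≤ _ := by linarith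
  have e3 : (√L.r11 * √L.r10 + √L.r01 * √L.r00) ^ 2 ≤ 4 * K * L.r11 := by
    refine le_trans ?_ e2
    have : √L.r11 * √L.r10 ≤ z * (√L.r11 * √L.r10) := le_mul_of_one_le_left (by positivity) hz
    gcongr
  have e4 : (L.r10 + L.r00) ^ 2 ≤ 1 := by
    have : L.r10 + L.r00 ≤ 1 := by linarith
    nlinarith
  have hexp := Real.add_one_le_exp ((2 : ℕ) * (5 * (1 + K) ^ 2 * L.r11))
  rw [← Real.exp_nat_mul]
  refine le_trans ?_ hexp
  have hsum : ∑ y, ∑ y', L.overlap z y y' ^ 2 = (z * L.r11 + L.r01) ^ 2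
      + (z * (√L.r11 * √L.r10) + √L.r01 * √L.r00) ^ 2
      + ((√L.r11 * √L.r10 + √L.r01 * √L.r00) ^ 2 + (L.r10 + L.r00) ^ 2) := by
    simp only [overlap, Fintype.sum_bool, prob, Bool.and_self, Bool.and_false, Bool.false_and,
      if_true, Bool.false_eq_true, if_false, Real.mul_self_sqrt hr,
      Real.mul_self_sqrt hp10, Real.mul_self_sqrt hp01, Real.mul_self_sqrt hp00]
    ring
  rw [hsum]
  have hKr : 0 ≤ K * L.r11 := by positivity
  have hK2r : 0 ≤ K ^ 2 * L.r11 := by positivity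
  push_cast
  linarith

end EdgeLaw

/-! ### Re-labellings and maximum likelihood -/

variable {n m : ℕ}

theorem movePair_mul (π τ : Equiv.Perm (Fin n)) (e : VertexPair n m) :
    movePair (π * τ) e = movePair π (movePair τ e) := by
  rcases e with e | ⟨i, v⟩
  · simp [movePair, Sym2.map_map]
  · simp [movePair]

theorem movePair_one (e : VertexPair n m) : movePair (1 : Equiv.Perm (Fin n)) e = e := by
  rcases e with e | ⟨i, v⟩
  · simp [movePair]
  · simp [movePair]

/-- The permutation of the vertex pairs induced by a permutation of the users. -/
def pairPerm (π : Equiv.Perm (Fin n)) : Equiv.Perm (VertexPair n m) where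
  toFun := movePair π
  invFun := movePair π⁻¹
  left_inv e := by rw [← movePair_mul, inv_mul_cancel, movePair_one]
  right_inv e := by rw [← movePair_mul, mul_inv_cancel, movePair_one]

@[simp] theorem pairPerm_apply (π : Equiv.Perm (Fin n)) (e : VertexPair n m) :
    pairPerm π e = movePair π e := rfl

theorem relabel_mul (π τ : Equiv.Perm (Fin n)) (g : AttrGraph n m) :
    relabel (π * τ) g = relabel π (relabel τ g) := by
  funext e
  simp only [relabel, mul_inv_rev, movePair_mul]

theorem relabel_one (g : AttrGraph n m) : relabel (1 : Equiv.Perm (Fin n)) g = g := by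
  funext e
  simp only [relabel, inv_one, movePair_one]

theorem jointProb_nonneg (p q : EdgeLaw) (g₁ g₂ : AttrGraph n m) : 0 ≤ jointProb p q g₁ g₂ :=
  Finset.prod_nonneg fun _ _ => EdgeLaw.prob_nonneg _ _ _

theorem sum_jointProb_eq_one (p q : EdgeLaw) :
    ∑ g₁ : AttrGraph n m, ∑ g₂ : AttrGraph n m, jointProb p q g₁ g₂ = 1 := by
  simp only [jointProb]
  rw [sum_sum_prod_eq fun e a b => (pairLaw p q e).prob a b]
  exact Finset.prod_eq_one fun e _ => EdgeLaw.sum_prob _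

open Classical in
/-- The probability of the event `A` for the pair `(G₁, G₂)`. -/
noncomputable def eventProb (p q : EdgeLaw) (A : AttrGraph n m → AttrGraph n m → Prop) : ℝ :=
  ∑ g₁ : AttrGraph n m, ∑ g₂ : AttrGraph n m, jointProb p q g₁ g₂ * if A g₁ g₂ then 1 else 0

/-- Some non-trivial re-labelling of the second graph is at least as likely as the truth. -/
def HasRival (p q : EdgeLaw) (g₁ g₂ : AttrGraph n m) : Prop :=
  ∃ τ : Equiv.Perm (Fin n), τ ≠ 1 ∧ jointProb p q g₁ g₂ ≤ jointProb p q g₁ (relabel τ g₂)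

/-- The maximum likelihood estimator errs only if the truth has a rival. -/
theorem exists_estimator_errorProb_le (p q : EdgeLaw) :
    ∃ est : Estimator n m, errorProb p q est ≤ eventProb p q (HasRival (n := n) (m := m) p q) := by
  classical
  have hmax : ∀ g₁ h : AttrGraph n m, ∃ π : Equiv.Perm (Fin n), ∀ τ : Equiv.Perm (Fin n),
      jointProb p q g₁ (relabel τ⁻¹ h) ≤ jointProb p q g₁ (relabel π⁻¹ h) := fun g₁ h =>
    Finite.exists_max fun π : Equiv.Perm (Fin n) => jointProb p q g₁ (relabel π⁻¹ h)
  choose est hest using hmax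
  refine ⟨est, ?_⟩
  have hpt : ∀ (π : Equiv.Perm (Fin n)) (g₁ g₂ : AttrGraph n m),
      ((n.factorial : ℝ)⁻¹ * jointProb p q g₁ g₂) * (if est g₁ (relabel π g₂) = π then 0 else 1)
      ≤ (n.factorial : ℝ)⁻¹ *
        (jointProb p q g₁ g₂ * if HasRival p q g₁ g₂ then 1 else 0) := by
    intro π g₁ g₂
    rw [mul_assoc]
    refine mul_le_mul_of_nonneg_left (mul_le_mul_of_nonneg_left ?_ (jointProb_nonneg _ _ _ _))
      (by positivity)
    by_cases h : est g₁ (relabel π g₂) = π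
    · rw [if_pos h]; split_ifs <;> norm_num
    · rw [if_neg h, if_pos]
      refine ⟨(est g₁ (relabel π g₂))⁻¹ * π, fun h1 => h (inv_mul_eq_one.1 h1), ?_⟩
      have := hest g₁ (relabel π g₂) π
      rwa [← relabel_mul, inv_mul_cancel, relabel_one, ← relabel_mul] at this
  refine (Finset.sum_le_sum fun π _ => Finset.sum_le_sum fun g₁ _ => Finset.sum_le_sum fun g₂ _ =>
    hpt π g₁ g₂).trans (le_of_eq ?_)
  simp_rw [← Finset.mul_sum]
  rw [Finset.sum_const, Finset.card_univ, Fintype.card_perm, Fintype.card_fin, nsmul_eq_mul,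
    ← mul_assoc, inv_mul_cancel₀ (by positivity), one_mul]
  rfl

/-! ### Overlap of the likelihoods under a re-labelling -/

/-- The user pair `e` contains a user of `S`. -/
def Touches (S : Finset (Fin n)) (e : UserPair n) : Prop := ∃ i ∈ S, i ∈ e.1

open Classical in
/-- The number of user pairs that touch `S` and are edges in both graphs. -/
noncomputable def hits (S : Finset (Fin n)) (g₁ g₂ : AttrGraph n m) : ℕ :=
  (Finset.univ.filter fun e : UserPair n =>
    Touches S e ∧ (g₁ (Sum.inl e) && g₂ (Sum.inl e)) = true).card

open Classical in
/-- The number of user pairs that touch `S`. -/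
noncomputable def touchCount (S : Finset (Fin n)) : ℕ :=
  (Finset.univ.filter fun e : UserPair n => Touches S e).card

open Classical in
/-- The number of user pairs that `τ` fixes as pairs, although not both of their users are fixed:
the pairs exchanged by `τ`. -/
noncomputable def swappedCount (τ : Equiv.Perm (Fin n)) : ℕ :=
  (Finset.univ.filter fun e : UserPair n => Touches τ.support e ∧ e.1.map τ = e.1).card

theorem map_eq_self_of_not_touches {τ : Equiv.Perm (Fin n)} {e : UserPair n}
    (h : ¬ Touches τ.support e) : e.1.map τ = e.1 := by
  rcases e with ⟨e, he⟩
  induction e with | _ i j => ?_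
  simp only [Touches, Equiv.Perm.mem_support, not_exists, not_and, Sym2.mem_iff] at h
  have hi : τ i = i := by by_contra hi; exact h i hi (Or.inl rfl)
  have hj : τ j = j := by by_contra hj; exact h j hj (Or.inr rfl)
  simp [hi, hj]

open Classical in
theorem exp_mul_hits (s : ℝ) (S : Finset (Fin n)) (g₁ g₂ : AttrGraph n m) :
    Real.exp (s * hits S g₁ g₂) = ∏ e : UserPair n,
      (if g₁ (Sum.inl e) && g₂ (Sum.inl e) then (if Touches S e then Real.exp s else 1) else 1) := by
  rw [mul_comm, Real.exp_nat_mul, hits, ← Finset.prod_const, Finset.prod_filter]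
  refine Finset.prod_congr rfl fun e _ => ?_
  by_cases h1 : Touches S e <;> by_cases h2 : (g₁ (Sum.inl e) && g₂ (Sum.inl e)) = true <;>
    simp [h1, h2]

/-- The overlap of the likelihoods of a graph pair and of its re-labelling, with a weight
`exp s` for each common user edge at a moved user. The hypotheses `hB` and `hF` control the weighted
overlap kernel at a moved user pair and at an exchanged one. -/
theorem sum_sqrt_jointProb_mul_le (p q : EdgeLaw) (τ : Equiv.Perm (Fin n)) {s B F : ℝ}
    (hB : ∑ y, ∑ y', p.overlap (Real.exp s) y y' ^ 2 ≤ Real.exp B ^ 2)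
    (hF : ∑ y, p.overlap (Real.exp s) y y ≤ Real.exp F) :
    ∑ g₁ : AttrGraph n m, ∑ g₂ : AttrGraph n m, Real.exp (s * hits τ.support g₁ g₂) *
        √(jointProb p q g₁ g₂ * jointProb p q g₁ (relabel τ g₂))
      ≤ Real.exp (((touchCount τ.support : ℝ) - swappedCount τ⁻¹) * B + swappedCount τ⁻¹ * F
          - τ.support.card * (m * q.gap)) := by
  classical
  -- `w` is the weight at a vertex pair, `b` the bound for its kernel
  let w : VertexPair n m → ℝ := Sum.elim (fun e => if Touches τ.support e then Real.exp s else 1)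
    fun _ => 1
  have hw : ∀ e, 0 ≤ w e := by
    rintro (e | e)
    · simp only [w, Sum.elim_inl]; split_ifs <;> positivity
    · simp [w]
  let b : VertexPair n m → ℝ := Sum.elim
    (fun e => if Touches τ.support e then (if e.1.map (τ⁻¹ : Equiv.Perm (Fin n)) = e.1 then Real.exp F
      else Real.exp B) else 1)
    fun iv => if τ iv.1 = iv.1 then 1 else Real.exp (-q.gap)
  have hsupp : (τ⁻¹).support = τ.support := Equiv.Perm.support_inv τ
  have hpt : ∀ g₁ g₂ : AttrGraph n m, Real.exp (s * hits τ.support g₁ g₂) *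
        √(jointProb p q g₁ g₂ * jointProb p q g₁ (relabel τ g₂))
      = ∏ e, ((if g₁ e && g₂ e then w e else 1) * (√((pairLaw p q e).prob (g₁ e) (g₂ e)) *
          √((pairLaw p q e).prob (g₁ e) (g₂ (pairPerm τ⁻¹ e))))) := by
    intro g₁ g₂
    rw [exp_mul_hits, Finset.prod_mul_distrib, Fintype.prod_sum_type]
    congr 1
    · simp [w]
    · rw [Real.sqrt_mul (jointProb_nonneg _ _ _ _), jointProb, jointProb,
        Real.sqrt_prod _ fun e _ => EdgeLaw.prob_nonneg _ _ _,
        Real.sqrt_prod _ fun e _ => EdgeLaw.prob_nonneg _ _ _, ← Finset.prod_mul_distrib]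
      rfl
  simp_rw [hpt]
  rw [Finset.sum_comm]
  have hsum : ∀ g₂ : AttrGraph n m, ∑ g₁ : AttrGraph n m, ∏ e,
      ((if g₁ e && g₂ e then w e else 1) * (√((pairLaw p q e).prob (g₁ e) (g₂ e)) *
          √((pairLaw p q e).prob (g₁ e) (g₂ (pairPerm τ⁻¹ e)))))
      = ∏ e, (pairLaw p q e).overlap (w e) (g₂ e) (g₂ (pairPerm τ⁻¹ e)) := by
    intro g₂
    simp only [EdgeLaw.overlap]
    rw [Finset.prod_univ_sum, Fintype.piFinset_univ]
  simp_rw [hsum]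
  refine (sum_prod_perm_le (pairPerm τ⁻¹) (fun e => (pairLaw p q e).overlap (w e)) b
    (fun e y z => EdgeLaw.overlap_nonneg _ (hw e) y z) ?_ ?_ ?_).trans (le_of_eq ?_)
  · rintro (e | e)
    · simp only [b, Sum.elim_inl]; split_ifs <;> positivity
    · simp only [b, Sum.elim_inr]; split_ifs <;> positivity
  · rintro (e | ⟨i, v⟩) he
    · have he' : e.1.map (τ⁻¹ : Equiv.Perm (Fin n)) ≠ e.1 := fun h => he (by
        simp only [pairPerm_apply, movePair]; congr 1; exact Subtype.ext h)
      have ht : Touches τ.support e := by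
        by_contra ht
        rw [← hsupp] at ht
        exact he' (map_eq_self_of_not_touches ht)
      simp only [b, w, Sum.elim_inl, if_pos ht, if_neg he', pairLaw]
      exact hB
    · have hi : τ i ≠ i := fun h => he (by
        simp only [pairPerm_apply, movePair]
        rw [Equiv.Perm.inv_eq_iff_eq.2 h.symm])
      simp only [b, w, Sum.elim_inr, if_neg hi, pairLaw]
      exact q.sum_overlap_one_sq_le
  · rintro (e | ⟨i, v⟩) he
    · have he' : e.1.map (τ⁻¹ : Equiv.Perm (Fin n)) = e.1 := by
        simp only [pairPerm_apply, movePair, Sum.inl.injEq] at he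
        exact congrArg Subtype.val he
      by_cases ht : Touches τ.support e
      · simp only [b, w, Sum.elim_inl, if_pos ht, if_pos he', pairLaw]
        exact hF
      · simp only [b, w, Sum.elim_inl, if_neg ht, pairLaw]
        rw [EdgeLaw.sum_overlap_diag]; simp
    · have hi : τ i = i := by
        simp only [pairPerm_apply, movePair, Sum.inr.injEq, Prod.mk.injEq, and_true] at he
        exact (Equiv.Perm.inv_eq_iff_eq.1 he).symm
      simp only [b, w, Sum.elim_inr, if_pos hi, pairLaw]
      rw [EdgeLaw.sum_overlap_diag]; simp
  · rw [Fintype.prod_sum_type, sub_eq_add_neg, Real.exp_add]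
    congr 1
    · simp only [b, Sum.elim_inl]
      rw [← Finset.prod_filter, Finset.prod_ite, Finset.prod_const, Finset.prod_const,
        ← Real.exp_nat_mul, ← Real.exp_nat_mul, ← Real.exp_add, Finset.filter_filter,
        add_comm]
      have h1 : (Finset.univ.filter fun e : UserPair n => Touches τ.support e ∧
          e.1.map (τ⁻¹ : Equiv.Perm (Fin n)) = e.1).card = swappedCount τ⁻¹ := by
        rw [swappedCount, hsupp]
      have h2 := Finset.card_filter_add_card_filter_not
        (s := Finset.univ.filter fun e : UserPair n => Touches τ.support e)
        (fun e : UserPair n => e.1.map (τ⁻¹ : Equiv.Perm (Fin n)) = e.1)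
      rw [Finset.filter_filter, h1] at h2
      have h3 : (touchCount τ.support : ℝ) = _ := congrArg (Nat.cast (R := ℝ)) h2.symm
      rw [h1, h3]
      push_cast
      congr 1
      ring
    · simp only [b, Sum.elim_inr]
      rw [Fintype.prod_prod_type]
      have hin : ∀ i, ∏ _v : Fin m, (if τ i = i then (1 : ℝ) else Real.exp (-q.gap))
          = if τ i = i then 1 else Real.exp (-q.gap) ^ m := by
        intro i; split_ifs <;> simp
      rw [Finset.prod_congr rfl fun i _ => hin i, ← Finset.prod_filter_mul_prod_filter_not _ (fun i => τ i = i)]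
      rw [Finset.prod_congr rfl fun i hi => if_pos (Finset.mem_filter.1 hi).2, Finset.prod_const_one,
        one_mul, Finset.prod_congr rfl fun i hi => if_neg (Finset.mem_filter.1 hi).2,
        Finset.prod_const, ← pow_mul, ← Real.exp_nat_mul]
      congr 1
      have : (Finset.univ.filter fun i => ¬ τ i = i) = τ.support := by ext; simp
      rw [this]
      push_cast
      ring

/-! ### Counting user pairs and permutations -/

/-- All user pairs but those within the complement of `S` touch `S`. -/
theorem le_touchCount (S : Finset (Fin n)) :
    (S.card : ℝ) * (2 * n - S.card - 1) / 2 ≤ touchCount S := by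
  classical
  have hle : S.card ≤ n := by simpa using Finset.card_le_univ S
  have hsplit := Finset.card_filter_add_card_filter_not
    (s := (Finset.univ : Finset (UserPair n))) (fun e => Touches S e)
  rw [Finset.card_univ, Sym2.card_subtype_not_diag, Fintype.card_fin] at hsplit
  have hun : (Finset.univ.filter fun e : UserPair n => ¬ Touches S e).card
      ≤ (n - S.card).choose 2 := by
    have hc : Sᶜ.card = n - S.card := by rw [Finset.card_compl, Fintype.card_fin]
    rw [← hc, ← Sym2.card_image_offDiag]
    refine Finset.card_le_card_of_injOn (fun e => e.1) ?_ (fun _ _ _ _ h => Subtype.ext h)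
    rintro ⟨e, he⟩ hmem
    induction e with | _ i j => ?_
    replace hmem := (Finset.mem_filter.1 (Finset.mem_coe.1 hmem)).2
    simp only [Touches, Sym2.mem_iff, not_exists, not_and] at hmem
    simp only [Finset.coe_image, Set.mem_image, Finset.mem_coe, Finset.mem_offDiag,
      Finset.mem_compl]
    exact ⟨(i, j), ⟨fun h => hmem i h (Or.inl rfl), fun h => hmem j h (Or.inr rfl),
      fun h => he (by simpa using h)⟩, rfl⟩
  have h1 : (n.choose 2 : ℝ) ≤ touchCount S + ((n - S.card).choose 2 : ℕ) := by
    have : n.choose 2 ≤ touchCount S + (n - S.card).choose 2 := by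
      rw [← hsplit]
      exact Nat.add_le_add le_rfl hun
    exact_mod_cast this
  rw [Nat.cast_choose_two, Nat.cast_choose_two, Nat.cast_sub hle] at h1
  linarith

theorem touchCount_le (S : Finset (Fin n)) : (touchCount S : ℝ) ≤ S.card * n := by
  classical
  have : touchCount S ≤ S.card * n := by
    calc touchCount S ≤ ((S ×ˢ (Finset.univ : Finset (Fin n))).image fun z => s(z.1, z.2)).card := by
          refine Finset.card_le_card_of_injOn (fun e => e.1) ?_ (fun _ _ _ _ h => Subtype.ext h)
          rintro ⟨e, he⟩ hmem
          replace hmem := (Finset.mem_filter.1 (Finset.mem_coe.1 hmem)).2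
          obtain ⟨i, hi, hie⟩ := hmem
          obtain ⟨j, rfl⟩ := hie
          simp only [Finset.coe_image, Set.mem_image, Finset.mem_coe]
          exact ⟨(i, j), by simp [hi], rfl⟩
      _ ≤ (S ×ˢ (Finset.univ : Finset (Fin n))).card := Finset.card_image_le
      _ = S.card * n := by simp
  exact_mod_cast this

/-- A pair that `τ` exchanges is of the form `{i, τ i}`. -/
theorem swappedCount_le (τ : Equiv.Perm (Fin n)) : (swappedCount τ : ℝ) ≤ τ.support.card := by
  classical
  have : swappedCount τ ≤ τ.support.card := by
    calc swappedCount τ ≤ (τ.support.image fun i => s(i, τ i)).card := by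
          refine Finset.card_le_card_of_injOn (fun e => e.1) ?_ (fun _ _ _ _ h => Subtype.ext h)
          rintro ⟨e, he⟩ hmem
          replace hmem := (Finset.mem_filter.1 (Finset.mem_coe.1 hmem)).2
          obtain ⟨⟨i, hi, hie⟩, hfix⟩ := hmem
          obtain ⟨j, rfl⟩ := hie
          simp only [Finset.coe_image, Set.mem_image, Finset.mem_coe]
          refine ⟨i, hi, ?_⟩
          rw [Sym2.map_mk, Sym2.eq_iff] at hfix
          rcases hfix with h | h
          · exact absurd h.1 (Equiv.Perm.mem_support.1 hi)
          · rw [h.1]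
      _ ≤ τ.support.card := Finset.card_image_le
  exact_mod_cast this

theorem card_filter_support_card_eq_le (n k : ℕ) :
    (Finset.univ.filter fun τ : Equiv.Perm (Fin n) => τ.support.card = k).card ≤ n ^ k := by
  classical
  have hS : ∀ S ∈ Finset.powersetCard k (Finset.univ : Finset (Fin n)),
      ((Finset.univ.filter fun τ : Equiv.Perm (Fin n) => τ.support.card = k).filter
        fun τ => τ.support = S).card ≤ k.factorial := by
    intro S hS
    rw [Finset.mem_powersetCard_univ] at hS
    have hcard : Fintype.card {f : Equiv.Perm (Fin n) // ∀ a, ¬ a ∈ S → f a = a}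
        = k.factorial := by
      rw [← Fintype.card_congr (Equiv.Perm.subtypeEquivSubtypePerm fun a => a ∈ S),
        Fintype.card_perm, Fintype.card_coe, hS]
    rw [← hcard, Fintype.card_subtype]
    refine Finset.card_le_card fun τ hτ => ?_
    simp only [Finset.mem_filter, Finset.mem_univ, true_and] at hτ ⊢
    intro a ha
    rw [← hτ.2, Equiv.Perm.mem_support, not_not] at ha
    exact ha
  rw [Finset.card_eq_sum_card_fiberwise (f := fun τ : Equiv.Perm (Fin n) => τ.support)
    (t := Finset.powersetCard k Finset.univ) fun τ hτ => by
      simpa using hτ]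
  refine (Finset.sum_le_card_nsmul _ _ _ hS).trans ?_
  rw [Finset.card_powersetCard, Finset.card_univ, Fintype.card_fin, smul_eq_mul, mul_comm,
    ← Nat.descFactorial_eq_factorial_mul_choose]
  exact Nat.descFactorial_le_pow n k

theorem sum_perm_le (f : ℕ → ℝ) (hf : ∀ k, 0 ≤ f k) :
    ∑ τ ∈ Finset.univ.filter (fun τ : Equiv.Perm (Fin n) => τ ≠ 1), f τ.support.card
      ≤ ∑ k ∈ Finset.Icc 1 n, (n : ℝ) ^ k * f k := by
  classical
  have hmaps : ∀ τ ∈ Finset.univ.filter (fun τ : Equiv.Perm (Fin n) => τ ≠ 1),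
      τ.support.card ∈ Finset.Icc 1 n := by
    intro τ hτ
    rw [Finset.mem_filter] at hτ
    rw [Finset.mem_Icc]
    refine ⟨?_, by simpa using Finset.card_le_univ τ.support⟩
    rw [Nat.one_le_iff_ne_zero, Ne, Finset.card_eq_zero, Equiv.Perm.support_eq_empty_iff]
    exact hτ.2
  rw [← Finset.sum_fiberwise_of_maps_to hmaps]
  refine Finset.sum_le_sum fun k _ => ?_
  rw [Finset.sum_congr rfl fun τ hτ => by rw [(Finset.mem_filter.1 hτ).2], Finset.sum_const,
    nsmul_eq_mul]
  refine mul_le_mul_of_nonneg_right ?_ (hf k)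
  have h := (Finset.card_le_card (Finset.filter_subset_filter
    (fun τ : Equiv.Perm (Fin n) => τ.support.card = k)
    (Finset.filter_subset (fun τ : Equiv.Perm (Fin n) => τ ≠ 1) Finset.univ))).trans
      (card_filter_support_card_eq_le n k)
  exact_mod_cast h

theorem choose_le_exp (n : ℕ) {k : ℕ} (hk : 0 < k) {x : ℝ} (hx : (n : ℝ) ≤ k * x) :
    (n.choose k : ℝ) ≤ Real.exp (k * (1 + Real.log x)) := by
  rcases Nat.eq_zero_or_pos n with rfl | hn
  · rw [Nat.choose_eq_zero_of_lt hk, Nat.cast_zero]; positivity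
  have hk' : (0 : ℝ) < k := by exact_mod_cast hk
  have hn' : (0 : ℝ) < n := by exact_mod_cast hn
  have hx0 : 0 < x := pos_of_mul_pos_right (hn'.trans_le hx) hk'.le
  have h1 := Nat.choose_le_pow_div (α := ℝ) k n
  have h2 := Real.pow_div_factorial_le_exp (k : ℝ) hk'.le k
  rw [div_le_iff₀ (by positivity)] at h2
  refine h1.trans ?_
  rw [div_le_iff₀ (by positivity)]
  calc (n : ℝ) ^ k ≤ (k * x) ^ k := by gcongr
    _ = (k : ℝ) ^ k * x ^ k := mul_pow _ _ _
    _ ≤ (Real.exp k * k.factorial) * x ^ k := by gcongr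
    _ = Real.exp k * x ^ k * k.factorial := by ring
    _ = Real.exp (k * (1 + Real.log x)) * k.factorial := by
        rw [mul_add, mul_one, Real.exp_add, Real.exp_nat_mul, Real.exp_log hx0]

theorem sum_Icc_pow_le {r : ℝ} (h0 : 0 ≤ r) (h1 : r ≤ 1 / 2) (n : ℕ) :
    ∑ k ∈ Finset.Icc 1 n, r ^ k ≤ 2 * r := by
  have h : ∀ n : ℕ, ∑ k ∈ Finset.Icc 1 n, r ^ k ≤ 2 * r - 2 * (r ^ n * r) := by
    intro n
    induction n with
    | zero => simp
    | succ n ih =>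
      rw [Finset.sum_Icc_succ_top (by omega), pow_succ]
      nlinarith [mul_nonneg (pow_nonneg h0 n) h0]
  have := h n
  nlinarith [mul_nonneg (pow_nonneg h0 n) h0]

/-! ### Common edges and the union bound -/

theorem sum_jointProb_mul_exp_hits (p q : EdgeLaw) (s : ℝ) (S : Finset (Fin n)) :
    ∑ g₁ : AttrGraph n m, ∑ g₂ : AttrGraph n m, jointProb p q g₁ g₂ *
      Real.exp (s * hits S g₁ g₂) = (1 + (Real.exp s - 1) * p.r11) ^ touchCount S := by
  classical
  let W : VertexPair n m → Bool → Bool → ℝ := Sum.elim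
    (fun e a b => if a && b then (if Touches S e then Real.exp s else 1) else 1) fun _ _ _ => 1
  have hpt : ∀ g₁ g₂ : AttrGraph n m, jointProb p q g₁ g₂ * Real.exp (s * hits S g₁ g₂)
      = ∏ e, (pairLaw p q e).prob (g₁ e) (g₂ e) * W e (g₁ e) (g₂ e) := by
    intro g₁ g₂
    rw [exp_mul_hits, Finset.prod_mul_distrib, jointProb]
    congr 1
    rw [Fintype.prod_sum_type]
    simp [W]
  simp_rw [hpt]
  rw [sum_sum_prod_eq fun e a b => (pairLaw p q e).prob a b * W e a b, Fintype.prod_sum_type]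
  have h2 : ∀ iv : Fin n × Fin m, ∑ a, ∑ b, (pairLaw p q (Sum.inr iv)).prob a b *
      W (Sum.inr iv) a b = 1 := by
    intro iv
    simp only [W, Sum.elim_inr, mul_one]
    exact EdgeLaw.sum_prob _
  have h1 : ∀ e : UserPair n, ∑ a, ∑ b, (pairLaw p q (Sum.inl e : VertexPair n m)).prob a b *
      W (Sum.inl e : VertexPair n m) a b
      = if Touches S e then 1 + (Real.exp s - 1) * p.r11 else 1 := by
    intro e
    simp only [W, Sum.elim_inl, pairLaw, Fintype.sum_bool, EdgeLaw.prob]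
    have := p.sum_eq_one
    by_cases h : Touches S e <;> simp [h] <;> linarith
  rw [Finset.prod_eq_one fun iv _ => h2 iv, mul_one, Finset.prod_congr rfl fun e _ => h1 e,
    ← Finset.prod_filter, Finset.prod_const]
  rfl

/-- Chernoff's bound for the lower tail of the number of common edges at a set of users. -/
theorem eventProb_hits_lt_le (p q : EdgeLaw) (S : Finset (Fin n)) (M : ℝ) :
    eventProb p q (fun g₁ g₂ : AttrGraph n m => (hits S g₁ g₂ : ℝ) < M)
      ≤ Real.exp (M - p.r11 * touchCount S / 2) := by
  classical
  calc eventProb p q (fun g₁ g₂ : AttrGraph n m => (hits S g₁ g₂ : ℝ) < M)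
      ≤ ∑ g₁ : AttrGraph n m, ∑ g₂ : AttrGraph n m, Real.exp M *
          (jointProb p q g₁ g₂ * Real.exp ((-1) * hits S g₁ g₂)) := by
        refine Finset.sum_le_sum fun g₁ _ => Finset.sum_le_sum fun g₂ _ => ?_
        have hJ := jointProb_nonneg p q g₁ g₂
        rw [mul_left_comm, ← Real.exp_add]
        refine mul_le_mul_of_nonneg_left ?_ hJ
        split_ifs with h
        · rw [Real.one_le_exp_iff]; linarith
        · positivity
    _ = Real.exp M * (1 + (Real.exp (-1) - 1) * p.r11) ^ touchCount S := by
        simp_rw [← Finset.mul_sum]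
        rw [sum_jointProb_mul_exp_hits]
    _ ≤ Real.exp M * Real.exp (-(p.r11 / 2)) ^ touchCount S := by
        have he : Real.exp (-1) ≤ 1 / 2 := by
          rw [Real.exp_neg, one_div]
          refine inv_anti₀ (by norm_num) ?_
          have := Real.add_one_le_exp (1 : ℝ)
          linarith
        have h0 := p.r11_nonneg
        have h1 := p.r11_le_one
        have h2 := Real.add_one_le_exp (-(p.r11 / 2))
        have h3 := Real.exp_pos (-1)
        refine mul_le_mul_of_nonneg_left (pow_le_pow_left₀ (by nlinarith) (by nlinarith) _)
          (by positivity)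
    _ = Real.exp (M - p.r11 * touchCount S / 2) := by
        rw [← Real.exp_nat_mul, ← Real.exp_add]
        congr 1; ring

/-- The union bound behind the achievability. Re-labellings of a `large` support are only
considered on the event that every large set `S` of users sees at least `M |S|` common edges;
on it the weight `exp (s (hits - M))` can be inserted for free. -/
theorem eventProb_hasRival_le_sum (p q : EdgeLaw) (large : ℕ → Prop) [DecidablePred large]
    (M : ℕ → ℝ) {s : ℝ} (hs : 0 ≤ s) (f : ℕ → ℝ)
    (hsmall : ∀ τ : Equiv.Perm (Fin n), τ ≠ 1 → ¬ large τ.support.card →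
      ∑ g₁ : AttrGraph n m, ∑ g₂ : AttrGraph n m,
        √(jointProb p q g₁ g₂ * jointProb p q g₁ (relabel τ g₂)) ≤ f τ.support.card)
    (hlarge : ∀ τ : Equiv.Perm (Fin n), τ ≠ 1 → large τ.support.card →
      Real.exp (-(s * M τ.support.card)) *
      ∑ g₁ : AttrGraph n m, ∑ g₂ : AttrGraph n m, Real.exp (s * hits τ.support g₁ g₂) *
        √(jointProb p q g₁ g₂ * jointProb p q g₁ (relabel τ g₂)) ≤ f τ.support.card) :
    eventProb p q (HasRival (n := n) (m := m) p q) ≤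
      (∑ τ ∈ Finset.univ.filter (fun τ : Equiv.Perm (Fin n) => τ ≠ 1), f τ.support.card) +
      ∑ S ∈ Finset.univ.filter (fun S : Finset (Fin n) => large S.card),
        eventProb p q (fun g₁ g₂ : AttrGraph n m => (hits S g₁ g₂ : ℝ) < M S.card) := by
  classical
  let R : Equiv.Perm (Fin n) → AttrGraph n m → AttrGraph n m → ℝ := fun τ g₁ g₂ =>
    (if large τ.support.card then
      Real.exp (-(s * M τ.support.card)) * Real.exp (s * hits τ.support g₁ g₂) else 1) *
    √(jointProb p q g₁ g₂ * jointProb p q g₁ (relabel τ g₂))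
  have hR : ∀ τ g₁ g₂, 0 ≤ R τ g₁ g₂ := fun τ g₁ g₂ => by
    simp only [R]; split_ifs <;> positivity
  have hRsum : ∀ τ ∈ Finset.univ.filter (fun τ : Equiv.Perm (Fin n) => τ ≠ 1),
      ∑ g₁, ∑ g₂, R τ g₁ g₂ ≤ f τ.support.card := by
    intro τ hτ
    have hτ1 := (Finset.mem_filter.1 hτ).2
    by_cases hl : large τ.support.card
    · refine le_trans (le_of_eq ?_) (hlarge τ hτ1 hl)
      simp only [R, if_pos hl, mul_assoc]
      simp_rw [← Finset.mul_sum]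
    · refine le_trans (le_of_eq ?_) (hsmall τ hτ1 hl)
      simp only [R, if_neg hl, one_mul]
  have hpt : ∀ g₁ g₂ : AttrGraph n m,
      jointProb p q g₁ g₂ * (if HasRival p q g₁ g₂ then 1 else 0) ≤
      (∑ τ ∈ Finset.univ.filter (fun τ : Equiv.Perm (Fin n) => τ ≠ 1), R τ g₁ g₂) +
      ∑ S ∈ Finset.univ.filter (fun S : Finset (Fin n) => large S.card),
        jointProb p q g₁ g₂ * if (hits S g₁ g₂ : ℝ) < M S.card then 1 else 0 := by
    intro g₁ g₂
    have hJ := jointProb_nonneg p q g₁ g₂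
    have hA : 0 ≤ ∑ τ ∈ Finset.univ.filter (fun τ : Equiv.Perm (Fin n) => τ ≠ 1), R τ g₁ g₂ :=
      Finset.sum_nonneg fun τ _ => hR τ g₁ g₂
    have hBt : ∀ S : Finset (Fin n), 0 ≤ jointProb p q g₁ g₂ *
        (if (hits S g₁ g₂ : ℝ) < M S.card then (1 : ℝ) else 0) := fun S => by
      split_ifs <;> simp [hJ]
    have hB := Finset.sum_nonneg (s := Finset.univ.filter
      (fun S : Finset (Fin n) => large S.card)) fun S _ => hBt S
    by_cases hriv : HasRival p q g₁ g₂
    · rw [if_pos hriv, mul_one]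
      by_cases hlow : ∃ S : Finset (Fin n), large S.card ∧ (hits S g₁ g₂ : ℝ) < M S.card
      · obtain ⟨S, hS, hSM⟩ := hlow
        have := Finset.single_le_sum (s := Finset.univ.filter
          (fun S : Finset (Fin n) => large S.card)) (fun S _ => hBt S)
          (Finset.mem_filter.2 ⟨Finset.mem_univ S, hS⟩)
        rw [if_pos hSM, mul_one] at this
        linarith
      · push Not at hlow
        obtain ⟨τ, hτ, hJτ⟩ := hriv
        have h1 := Finset.single_le_sum (s := Finset.univ.filter
          (fun τ : Equiv.Perm (Fin n) => τ ≠ 1)) (fun τ _ => hR τ g₁ g₂)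
          (Finset.mem_filter.2 ⟨Finset.mem_univ τ, hτ⟩)
        have h2 : jointProb p q g₁ g₂ ≤
            √(jointProb p q g₁ g₂ * jointProb p q g₁ (relabel τ g₂)) := by
          refine Real.le_sqrt_of_sq_le ?_
          rw [sq]; gcongr
        have h3 : √(jointProb p q g₁ g₂ * jointProb p q g₁ (relabel τ g₂)) ≤ R τ g₁ g₂ := by
          simp only [R]
          refine le_mul_of_one_le_left (Real.sqrt_nonneg _) ?_
          split_ifs with hl
          · rw [← Real.exp_add, Real.one_le_exp_iff]
            nlinarith [hlow τ.support hl]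
          · exact le_rfl
        linarith
    · rw [if_neg hriv, mul_zero]
      positivity
  refine (Finset.sum_le_sum fun g₁ _ => Finset.sum_le_sum fun g₂ _ => hpt g₁ g₂).trans ?_
  simp_rw [Finset.sum_add_distrib]
  refine add_le_add ?_ (le_of_eq ?_)
  · refine le_trans (le_of_eq ?_) (Finset.sum_le_sum hRsum)
    rw [Finset.sum_comm (s := Finset.univ.filter fun τ : Equiv.Perm (Fin n) => τ ≠ 1)]
    exact Finset.sum_congr rfl fun g₁ _ => Finset.sum_comm
  · simp only [eventProb]
    rw [Finset.sum_comm (s := Finset.univ.filter fun S : Finset (Fin n) => large S.card)]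
    exact Finset.sum_congr rfl fun g₁ _ => Finset.sum_comm

/-! ### Achievability -/

theorem sum_sqrt_jointProb_le (p q : EdgeLaw) (τ : Equiv.Perm (Fin n)) :
    ∑ g₁ : AttrGraph n m, ∑ g₂ : AttrGraph n m,
        √(jointProb p q g₁ g₂ * jointProb p q g₁ (relabel τ g₂))
      ≤ Real.exp (-(((touchCount τ.support : ℝ) - swappedCount τ⁻¹) * p.gap
          + τ.support.card * (m * q.gap))) := by
  have h := sum_sqrt_jointProb_mul_le (m := m) p q τ (s := 0) (B := -p.gap) (F := 0)
    (by rw [Real.exp_zero]; exact p.sum_overlap_one_sq_le)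
    (by rw [Real.exp_zero, p.sum_overlap_diag]; simp)
  simp only [zero_mul, Real.exp_zero, one_mul] at h
  refine h.trans (le_of_eq ?_)
  congr 1; ring

theorem le_movedCount (τ : Equiv.Perm (Fin n)) :
    (τ.support.card : ℝ) * (2 * n - τ.support.card - 3) / 2
      ≤ touchCount τ.support - swappedCount τ⁻¹ := by
  have h1 := le_touchCount τ.support
  have h2 := swappedCount_le τ⁻¹
  rw [Equiv.Perm.support_inv] at h2
  linarith

theorem card_support_le (τ : Equiv.Perm (Fin n)) : (τ.support.card : ℝ) ≤ n := by
  exact_mod_cast (show τ.support.card ≤ n by simpa using Finset.card_le_univ τ.support)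

/-- If the user graphs are so dense that `n * r11 ≥ K log n` with a large constant `K`, the user
edges alone align the graphs, by a union bound over all re-labellings. -/
theorem eventProb_hasRival_le_of_dense {δ : ℝ} (hδ : 0 < δ) (hn : 6 ≤ n) {p : EdgeLaw}
    (q : EdgeLaw) (hp : p.AtLeast δ) (hx : 8 * Real.log n ≤ δ ^ 4 / 4 * (n * p.r11)) :
    eventProb p q (HasRival (n := n) (m := m) p q) ≤ 2 * (n : ℝ)⁻¹ := by
  have hn' : (6 : ℝ) ≤ n := by exact_mod_cast hn
  have hn0 : (0 : ℝ) < n := by linarith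
  have hgap := hp.gap_ge hδ
  have h := eventProb_hasRival_le_sum (n := n) (m := m) p q (fun _ => False) (fun _ => 0) le_rfl
    (fun k => ((n : ℝ) ^ (2 * k))⁻¹) ?_ (fun τ _ hF => hF.elim)
  · simp only [Finset.filter_false, Finset.sum_empty, add_zero] at h
    refine (h.trans (sum_perm_le (fun k => ((n : ℝ) ^ (2 * k))⁻¹) fun k => by positivity)).trans ?_
    refine le_trans (le_of_eq (Finset.sum_congr rfl fun k _ => ?_))
      (sum_Icc_pow_le (r := (n : ℝ)⁻¹) (by positivity) ?_ n)
    · rw [pow_mul', sq, inv_pow]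
      field_simp
    · rw [one_div]; exact inv_anti₀ (by norm_num) (by linarith)
  · intro τ _ _
    refine (sum_sqrt_jointProb_le p q τ).trans ?_
    have hk := card_support_le τ
    have hmv := le_movedCount τ
    set k := τ.support.card
    have hk0 : (0 : ℝ) ≤ k := Nat.cast_nonneg _
    have h1 : (k : ℝ) * n / 4 ≤ touchCount τ.support - swappedCount τ⁻¹ := by
      refine le_trans ?_ hmv
      nlinarith
    have h2 : (k : ℝ) * n / 4 * (δ ^ 4 / 4 * p.r11)
        ≤ (touchCount τ.support - swappedCount τ⁻¹) * p.gap :=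
      mul_le_mul h1 hgap (mul_nonneg (by positivity) p.r11_nonneg) (le_trans (by positivity) h1)
    have h3 : 0 ≤ (k : ℝ) * (m * q.gap) := mul_nonneg hk0 (mul_nonneg (by positivity) q.gap_nonneg)
    have h4 : (k : ℝ) * (8 * Real.log n) ≤ k * (δ ^ 4 / 4 * (n * p.r11)) := by gcongr
    have h5 : ((n : ℝ) ^ (2 * k))⁻¹ = Real.exp (-(k * (2 * Real.log n))) := by
      rw [Real.exp_neg, mul_comm (2 : ℕ) k, pow_mul, ← Real.exp_log (pow_pos (pow_pos hn0 k) 2),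
        Real.log_pow, Real.log_pow]
      push_cast
      congr 2; ring
    rw [h5, Real.exp_le_exp]
    linarith

/-- If `n * r11 ≤ K log n`, a re-labelling with a support of size `k` at most `300 / r11` is
handled at the cost of a constant factor per moved user. -/
theorem sum_sqrt_jointProb_le_of_sparse {δ : ℝ} (hδ : 0 < δ) (hn : 3 ≤ n) {p : EdgeLaw}
    (q : EdgeLaw) (hp : p.AtLeast δ) (hx : (n * p.r11) ^ 3 ≤ n) (τ : Equiv.Perm (Fin n))
    (hτ : (τ.support.card : ℝ) * (n * p.r11) ≤ n * 300) {u : ℝ}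
    (hu : u ≤ n * p.r11 + m * q.gap) :
    ∑ g₁ : AttrGraph n m, ∑ g₂ : AttrGraph n m,
        √(jointProb p q g₁ g₂ * jointProb p q g₁ (relabel τ g₂))
      ≤ Real.exp (303 + 4 * (δ ^ 4)⁻¹ - u) ^ τ.support.card := by
  have hn' : (3 : ℝ) ≤ n := by exact_mod_cast hn
  have hn0 : (0 : ℝ) < n := by linarith
  refine (sum_sqrt_jointProb_le p q τ).trans ?_
  have hgap := hp.gap_ge_sub hδ
  have hk := card_support_le τ
  have hmv := le_movedCount τ
  have hr := p.r11_nonneg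
  have hr1 := p.r11_le_one
  set k := τ.support.card
  set K := (δ ^ 4)⁻¹ with hK
  have hK0 : 0 < K := by positivity
  have hk0 : (0 : ℝ) ≤ k := Nat.cast_nonneg _
  set T : ℝ := k * (2 * n - k - 3) / 2 with hT
  have hT0 : 0 ≤ T := by
    rw [hT]; exact div_nonneg (mul_nonneg hk0 (by linarith)) (by norm_num)
  have hTn : T ≤ k * n := by rw [hT]; nlinarith
  have hkr : (k : ℝ) * p.r11 ≤ 300 := by
    refine le_of_mul_le_mul_right ?_ hn0
    linarith
  have hsq : (n : ℝ) * (p.r11 * √p.r11) ≤ 1 := by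
    refine (sq_le_one_iff₀ (by positivity)).1 ?_
    rw [mul_pow, mul_pow, Real.sq_sqrt hr]
    refine le_of_mul_le_mul_right ?_ hn0
    linarith
  have h1 : T * (p.r11 - (1 + 4 * K) * (p.r11 * √p.r11))
      ≤ (touchCount τ.support - swappedCount τ⁻¹) * p.gap :=
    (mul_le_mul_of_nonneg_left hgap hT0).trans
      (mul_le_mul_of_nonneg_right hmv p.gap_nonneg)
  have h2 : T * ((1 + 4 * K) * (p.r11 * √p.r11)) ≤ k * (1 + 4 * K) := by
    calc T * ((1 + 4 * K) * (p.r11 * √p.r11)) ≤ k * n * ((1 + 4 * K) * (p.r11 * √p.r11)) := by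
          gcongr
      _ = k * (1 + 4 * K) * (n * (p.r11 * √p.r11)) := by ring
      _ ≤ k * (1 + 4 * K) * 1 := by gcongr
      _ = _ := mul_one _
  have h3 : T * p.r11 = k * (n * p.r11) - k * (k * p.r11) / 2 - k * p.r11 * (3 / 2) := by
    rw [hT]; ring
  have h4 : (k : ℝ) * (k * p.r11) ≤ k * 300 := by gcongr
  have h5 : (k : ℝ) * p.r11 ≤ k * 1 := by gcongr
  have h6 : (k : ℝ) * u ≤ k * (n * p.r11 + m * q.gap) := by gcongr
  rw [← Real.exp_nat_mul, Real.exp_le_exp]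
  linarith

/-- The bound for re-labellings of many users: on the event of many common edges these edges
would have to be matched by chance. The weight `exp s` of a common edge is `n ^ (1/4)`: small enough
to keep the Frobenius norm of the weighted overlap at `1 + O(r11)`, and large enough to gain a
factor `n ^ (-k x / 64)` from `k x / 16` common edges. -/
theorem exp_mul_sum_sqrt_jointProb_le {δ : ℝ} (hδ : 0 < δ) (hn : 0 < n) {p : EdgeLaw}
    (q : EdgeLaw) (hp : p.AtLeast δ) (hx : (n * p.r11) ^ 2 ≤ n) (hx300 : 300 ≤ n * p.r11)
    (hlog : 128 * (5 * (1 + (δ ^ 4)⁻¹) ^ 2 + 2) ≤ Real.log n) (τ : Equiv.Perm (Fin n))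
    (hτ : n * 300 < (τ.support.card : ℝ) * (n * p.r11)) :
    Real.exp (-(Real.log n / 4 * (τ.support.card * (n * p.r11) / 16))) *
      ∑ g₁ : AttrGraph n m, ∑ g₂ : AttrGraph n m,
        Real.exp (Real.log n / 4 * hits τ.support g₁ g₂) *
        √(jointProb p q g₁ g₂ * jointProb p q g₁ (relabel τ g₂))
      ≤ ((n : ℝ) ^ τ.support.card)⁻¹ * Real.exp (-n) := by
  have hn0 : (0 : ℝ) < n := by exact_mod_cast hn
  have hlog0 : 0 < Real.log n := lt_of_lt_of_le (by positivity) hlog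
  have hr := p.r11_nonneg
  have hz1 : 1 ≤ Real.exp (Real.log n / 4) := by rw [Real.one_le_exp_iff]; linarith
  have hzn : Real.exp (Real.log n / 4) ≤ n := by
    rw [← Real.le_log_iff_exp_le hn0]; linarith
  have hz2 : Real.exp (Real.log n / 4) ^ 2 * p.r11 ≤ 1 := by
    refine (sq_le_one_iff₀ (by positivity)).1 ?_
    have : (Real.exp (Real.log n / 4) ^ 2) ^ 2 = n := by
      rw [← pow_mul, ← Real.exp_nat_mul]
      push_cast
      rw [show (4 : ℝ) * (Real.log n / 4) = Real.log n by ring, Real.exp_log hn0]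
    rw [mul_pow, this]
    refine le_of_mul_le_mul_right ?_ hn0
    linarith
  have hB := hp.sum_overlap_sq_le hδ hz1 hz2
  have hF : ∑ y, p.overlap (Real.exp (Real.log n / 4)) y y ≤ Real.exp (n * p.r11) := by
    rw [p.sum_overlap_diag]
    have := Real.add_one_le_exp (n * p.r11)
    nlinarith
  have h := sum_sqrt_jointProb_mul_le (m := m) p q τ hB hF
  refine (mul_le_mul_of_nonneg_left h (Real.exp_pos _).le).trans ?_
  have hk := card_support_le τ
  have ht := touchCount_le τ.support
  have hs := swappedCount_le τ⁻¹
  rw [Equiv.Perm.support_inv] at hs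
  set k := τ.support.card
  set B := 5 * (1 + (δ ^ 4)⁻¹) ^ 2 with hBdef
  have hB0 : 0 < B := by positivity
  set x := (n : ℝ) * p.r11 with hxdef
  have hk0 : (0 : ℝ) ≤ k := Nat.cast_nonneg _
  have hpow : ((n : ℝ) ^ k)⁻¹ = Real.exp (-(k * Real.log n)) := by
    rw [Real.exp_neg, Real.exp_nat_mul, Real.exp_log hn0]
  rw [hpow, ← Real.exp_add, ← Real.exp_add, Real.exp_le_exp]
  have h1 : ((touchCount τ.support : ℝ) - swappedCount τ⁻¹) * (B * p.r11) ≤ B * (k * x) := by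
    have h0 : ((touchCount τ.support : ℝ) - swappedCount τ⁻¹) ≤ k * n := by
      linarith [Nat.cast_nonneg (α := ℝ) (swappedCount τ⁻¹)]
    calc ((touchCount τ.support : ℝ) - swappedCount τ⁻¹) * (B * p.r11)
        ≤ k * n * (B * p.r11) := by gcongr
      _ = B * (k * x) := by rw [hxdef]; ring
  have h2 : (swappedCount τ⁻¹ : ℝ) * x ≤ k * x := by gcongr
  have h3 : 0 ≤ (k : ℝ) * (m * q.gap) := mul_nonneg hk0 (mul_nonneg (by positivity) q.gap_nonneg)
  have h4 : (k : ℝ) * Real.log n * 128 ≤ k * Real.log n * x := by gcongr; linarith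
  have h5 : k * x * (128 * (B + 2)) ≤ k * x * Real.log n := by gcongr
  linarith

/-- With high probability every large set of users sees many common edges. -/
theorem sum_eventProb_hits_lt_le (hn : 2 ≤ n) (p q : EdgeLaw) (hx300 : 300 ≤ n * p.r11) :
    ∑ S ∈ Finset.univ.filter
        (fun S : Finset (Fin n) => (n : ℝ) * 300 < (S.card : ℕ) * (n * p.r11)),
      eventProb p q (fun g₁ g₂ : AttrGraph n m =>
        (hits S g₁ g₂ : ℝ) < (S.card : ℕ) * (n * p.r11) / 16)
      ≤ (n + 1) * Real.exp (-n) := by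
  have hn2 : (2 : ℝ) ≤ n := by exact_mod_cast hn
  have hn0 : (0 : ℝ) < n := by linarith
  obtain ⟨x, hxdef⟩ : ∃ x, x = (n : ℝ) * p.r11 := ⟨_, rfl⟩
  rw [← hxdef] at hx300 ⊢
  have hx0 : 0 < x := by linarith
  have hlogx : 1 + Real.log x ≤ x / 32 := by
    have h1 : Real.log x = Real.log (x / 64) + Real.log 64 := by
      rw [← Real.log_mul (by positivity) (by norm_num)]; congr 1; ring
    have h2 := Real.log_le_sub_one_of_pos (show 0 < x / 64 by positivity)
    have h3 : Real.log 64 = 6 * Real.log 2 := by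
      rw [show (64 : ℝ) = 2 ^ 6 by norm_num, Real.log_pow]; norm_num
    have := Real.log_two_lt_d9
    linarith
  -- `exp (-k x / 16)` must beat the number `(e x) ^ k` of sets; this is why `x ≥ 300`
  let F : ℕ → ℝ := fun k => if (n : ℝ) * 300 < k * x then Real.exp (-(k * x / 16)) else 0
  calc _ ≤ ∑ S ∈ Finset.univ.filter (fun S : Finset (Fin n) => (n : ℝ) * 300 < (S.card : ℕ) * x),
        Real.exp (-((S.card : ℕ) * x / 16)) := by
        refine Finset.sum_le_sum fun S _ => (eventProb_hits_lt_le p q S _).trans ?_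
        rw [Real.exp_le_exp]
        have hk : (S.card : ℝ) ≤ n := by
          exact_mod_cast (show S.card ≤ n by simpa using Finset.card_le_univ S)
        have hk0 : (0 : ℝ) ≤ S.card := Nat.cast_nonneg _
        have h1 : (S.card : ℝ) * n / 4 ≤ touchCount S := by
          refine le_trans ?_ (le_touchCount S)
          nlinarith
        have h2 := mul_le_mul_of_nonneg_left h1 p.r11_nonneg
        rw [hxdef]
        linarith
    _ = ∑ S ∈ (Finset.univ : Finset (Fin n)).powerset, F S.card := by
        rw [Finset.sum_filter, Finset.powerset_univ]
    _ = ∑ k ∈ Finset.range (n + 1), n.choose k • F k := by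
        rw [Finset.sum_powerset_apply_card F, Finset.card_univ, Fintype.card_fin]
    _ ≤ ∑ k ∈ Finset.range (n + 1), Real.exp (-n) := by
        refine Finset.sum_le_sum fun k _ => ?_
        rw [nsmul_eq_mul]
        by_cases hk : (n : ℝ) * 300 < k * x
        · simp only [F, if_pos hk]
          have hk1 : 0 < k := by
            rcases Nat.eq_zero_or_pos k with rfl | h
            · norm_num at hk; linarith
            · exact h
          refine (mul_le_mul_of_nonneg_right (choose_le_exp n hk1 (x := x) (by linarith))
            (Real.exp_pos _).le).trans ?_
          rw [← Real.exp_add, Real.exp_le_exp]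
          have : (k : ℝ) * (1 + Real.log x) ≤ k * (x / 32) := by gcongr
          linarith
        · simp only [F, if_neg hk, mul_zero]
          positivity
    _ = (n + 1) * Real.exp (-n) := by
        rw [Finset.sum_const, Finset.card_range, nsmul_eq_mul]; push_cast; ring

/-- The union bound for `n * r11` of order at most `log n`, with re-labellings classified by whether
their support is larger than `300 / r11`. -/
theorem eventProb_hasRival_le_of_not_dense {δ : ℝ} (hδ : 0 < δ) (hn : 3 ≤ n) {p : EdgeLaw}
    (q : EdgeLaw) (hp : p.AtLeast δ) (hx2 : (n * p.r11) ^ 2 ≤ n) (hx3 : (n * p.r11) ^ 3 ≤ n)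
    (hlog : 128 * (5 * (1 + (δ ^ 4)⁻¹) ^ 2 + 2) ≤ Real.log n) {t : ℝ}
    (ht : Real.log n + t ≤ n * p.r11 + m * q.gap) (ht1 : 304 + 4 * (δ ^ 4)⁻¹ ≤ t) :
    eventProb p q (HasRival (n := n) (m := m) p q) ≤
      2 * Real.exp (303 + 4 * (δ ^ 4)⁻¹ - t) + (2 * n + 1) * Real.exp (-n) := by
  classical
  have hn' : (3 : ℝ) ≤ n := by exact_mod_cast hn
  have hn0 : (0 : ℝ) < n := by linarith
  have hlog0 : 0 < Real.log n := lt_of_lt_of_le (by positivity) hlog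
  set C := 303 + 4 * (δ ^ 4)⁻¹ with hC
  have hlarge300 : ∀ k : ℕ, k ≤ n → (n : ℝ) * 300 < k * (n * p.r11) → 300 ≤ n * p.r11 := by
    intro k hk h
    have hk' : (k : ℝ) ≤ n := by exact_mod_cast hk
    by_contra! hlt
    nlinarith [mul_nonneg hn0.le p.r11_nonneg]
  have h := eventProb_hasRival_le_sum (n := n) (m := m) p q
    (fun k : ℕ => (n : ℝ) * 300 < k * (n * p.r11)) (fun k => k * (n * p.r11) / 16)
    (s := Real.log n / 4) (by linarith)
    (fun k => ((n : ℝ) ^ k)⁻¹ * Real.exp (-n) + Real.exp (C - (Real.log n + t)) ^ k) ?_ ?_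
  · refine h.trans ?_
    have hexp : (n : ℝ) * Real.exp (C - (Real.log n + t)) = Real.exp (C - t) := by
      rw [show C - (Real.log n + t) = -Real.log n + (C - t) by ring, Real.exp_add, Real.exp_neg,
        Real.exp_log hn0, mul_inv_cancel_left₀ hn0.ne']
    have h1 := sum_perm_le (n := n)
      (fun k => ((n : ℝ) ^ k)⁻¹ * Real.exp (-n) + Real.exp (C - (Real.log n + t)) ^ k)
      fun k => by positivity
    have h2 : ∑ k ∈ Finset.Icc 1 n, (n : ℝ) ^ k *
        (((n : ℝ) ^ k)⁻¹ * Real.exp (-n) + Real.exp (C - (Real.log n + t)) ^ k)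
        ≤ n * Real.exp (-n) + 2 * Real.exp (C - t) := by
      calc _ = ∑ k ∈ Finset.Icc 1 n, (Real.exp (-n) + Real.exp (C - t) ^ k) := by
            refine Finset.sum_congr rfl fun k _ => ?_
            rw [mul_add, mul_inv_cancel_left₀ (by positivity), ← mul_pow, hexp]
        _ ≤ n * Real.exp (-n) + 2 * Real.exp (C - t) := by
            rw [Finset.sum_add_distrib, Finset.sum_const, Nat.card_Icc, nsmul_eq_mul]
            refine add_le_add (by simp) (sum_Icc_pow_le (by positivity) ?_ n)
            have he := Real.add_one_le_exp (1 : ℝ)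
            calc Real.exp (C - t) ≤ Real.exp (-1) := by rw [Real.exp_le_exp]; linarith
              _ ≤ 1 / 2 := by
                rw [Real.exp_neg, one_div]; exact inv_anti₀ (by norm_num) (by linarith)
    have h3 : ∑ S ∈ Finset.univ.filter
        (fun S : Finset (Fin n) => (n : ℝ) * 300 < (S.card : ℕ) * (n * p.r11)),
      eventProb p q (fun g₁ g₂ : AttrGraph n m =>
        (hits S g₁ g₂ : ℝ) < (S.card : ℕ) * (n * p.r11) / 16) ≤ (n + 1) * Real.exp (-n) := by
      by_cases h300 : 300 ≤ n * p.r11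
      · exact sum_eventProb_hits_lt_le (by omega) p q h300
      · rw [Finset.filter_false_of_mem, Finset.sum_empty]
        · positivity
        · exact fun S _ hS => h300 (hlarge300 S.card (by simpa using Finset.card_le_univ S) hS)
    linarith
  · intro τ _ hl
    refine (sum_sqrt_jointProb_le_of_sparse hδ hn q hp hx3 τ (not_lt.1 hl) ht).trans ?_
    have : 0 ≤ ((n : ℝ) ^ τ.support.card)⁻¹ * Real.exp (-n) := by positivity
    linarith
  · intro τ _ hl
    refine (exp_mul_sum_sqrt_jointProb_le hδ (by omega) q hp hx2
      (hlarge300 _ (by simpa using Finset.card_le_univ τ.support) hl) hlog τ hl).trans ?_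
    have : 0 ≤ Real.exp (C - (Real.log n + t)) ^ τ.support.card := by positivity
    linarith

theorem tendsto_log_natCast_atTop : Tendsto (fun n : ℕ => Real.log n) atTop atTop :=
  Real.tendsto_log_atTop.comp tendsto_natCast_atTop_atTop

theorem eventually_mul_log_pow_le (K : ℝ) (j : ℕ) :
    ∀ᶠ n : ℕ in atTop, (K * Real.log n) ^ j ≤ n := by
  have h : (fun n : ℕ => K ^ j * Real.log n ^ j) =o[atTop] fun n : ℕ => (n : ℝ) :=
    ((Real.isLittleO_pow_log_id_atTop (n := j)).comp_tendsto tendsto_natCast_atTop_atTop).const_mul_left _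
  filter_upwards [h.bound one_pos] with n hn
  rw [one_mul, Real.norm_eq_abs, Real.norm_eq_abs, Nat.abs_cast] at hn
  rw [mul_pow]
  exact (le_abs_self _).trans hn

/-- Alignment succeeds as soon as `n * r11` together with the Bhattacharyya gaps of the attribute
edges exceeds `log n` by a diverging amount. -/
theorem achievable_of_tendsto_gap {m : ℕ → ℕ} {p q : ℕ → EdgeLaw} {δ : ℝ} (hδ : 0 < δ)
    (hp : ∀ᶠ n in atTop, (p n).AtLeast δ)
    (ht : Tendsto (fun n : ℕ => n * (p n).r11 + m n * (q n).gap - Real.log n) atTop atTop) :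
    ExactAlignmentAchievable m p q := by
  choose est hest using fun n => exists_estimator_errorProb_le (n := n) (m := m n) (p n) (q n)
  refine ⟨est, ?_⟩
  have hnonneg : ∀ n, 0 ≤ errorProb (p n) (q n) (est n) := by
    intro n
    refine Finset.sum_nonneg fun π _ => Finset.sum_nonneg fun g₁ _ => Finset.sum_nonneg fun g₂ _ =>
      mul_nonneg (mul_nonneg (by positivity) (jointProb_nonneg _ _ _ _)) ?_
    split_ifs <;> norm_num
  set C := 303 + 4 * (δ ^ 4)⁻¹ with hC
  let t : ℕ → ℝ := fun n => n * (p n).r11 + m n * (q n).gap - Real.log n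
  have hlim : Tendsto (fun n : ℕ => 2 * Real.exp (C - t n) + (2 * n + 1) * Real.exp (-n)
      + 2 * (n : ℝ)⁻¹) atTop (𝓝 0) := by
    have h1 : Tendsto (fun n => Real.exp (C - t n)) atTop (𝓝 0) :=
      Real.tendsto_exp_atBot.comp (tendsto_atBot_add_const_left _ C (tendsto_neg_atTop_atBot.comp ht))
    have h2 : Tendsto (fun n : ℕ => (n : ℝ) * Real.exp (-n)) atTop (𝓝 0) := by
      have := (Real.tendsto_pow_mul_exp_neg_atTop_nhds_zero 1).comp
        (tendsto_natCast_atTop_atTop (R := ℝ))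
      simpa [Function.comp_def] using this
    have h3 : Tendsto (fun n : ℕ => Real.exp (-(n : ℝ))) atTop (𝓝 0) :=
      Real.tendsto_exp_neg_atTop_nhds_zero.comp (tendsto_natCast_atTop_atTop (R := ℝ))
    have h4 : Tendsto (fun n : ℕ => (n : ℝ)⁻¹) atTop (𝓝 0) := tendsto_inv_atTop_nhds_zero_nat
    have := ((h1.const_mul 2).add ((h2.const_mul 2).add h3)).add (h4.const_mul 2)
    simp only [mul_zero, add_zero] at this
    refine this.congr fun n => ?_
    ring
  refine squeeze_zero' (Eventually.of_forall hnonneg) ?_ hlim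
  have hc : 0 < δ ^ 4 / 4 := by positivity
  filter_upwards [hp, ht.eventually_ge_atTop (304 + 4 * (δ ^ 4)⁻¹), eventually_ge_atTop 6,
    eventually_mul_log_pow_le (8 / (δ ^ 4 / 4)) 2, eventually_mul_log_pow_le (8 / (δ ^ 4 / 4)) 3,
    tendsto_log_natCast_atTop.eventually_ge_atTop (128 * (5 * (1 + (δ ^ 4)⁻¹) ^ 2 + 2))]
    with n hpn htn hn6 hl2 hl3 hlog
  refine (hest n).trans ?_
  have e1 : 0 ≤ 2 * Real.exp (C - t n) := by positivity
  have e2 : 0 ≤ (2 * n + 1) * Real.exp (-n) := by positivity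
  have e3 : 0 ≤ 2 * (n : ℝ)⁻¹ := by positivity
  by_cases hx : 8 * Real.log n ≤ δ ^ 4 / 4 * (n * (p n).r11)
  · have := eventProb_hasRival_le_of_dense (m := m n) hδ hn6 (q n) hpn hx
    linarith
  · have hx0 : 0 ≤ n * (p n).r11 := mul_nonneg (Nat.cast_nonneg _) (p n).r11_nonneg
    have hx' : n * (p n).r11 ≤ 8 / (δ ^ 4 / 4) * Real.log n := by
      rw [div_mul_eq_mul_div, le_div_iff₀ hc]; linarith
    have := eventProb_hasRival_le_of_not_dense (m := m n) hδ (by omega) (q n) hpn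
      ((pow_le_pow_left₀ hx0 hx' 2).trans hl2) ((pow_le_pow_left₀ hx0 hx' 3).trans hl3) hlog
      (t := t n) (by simp only [t]; linarith) htn
    linarith

/-! ### Converse -/

/-- No estimator beats a coin flip when the truth has a rival: of the two competing permutations
the estimator names at most one. -/
theorem eventProb_hasRival_le_errorProb_add (p q : EdgeLaw) (est : Estimator n m) :
    eventProb p q (HasRival (n := n) (m := m) p q) ≤ errorProb p q est + 1 / 2 := by
  classical
  have hfac : (0 : ℝ) < n.factorial := by positivity
  -- re-labelling is a bijection of the second graph
  have hbij : ∀ (π : Equiv.Perm (Fin n)) (f : AttrGraph n m → ℝ),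
      ∑ g₂, f g₂ = ∑ h, f (relabel π⁻¹ h) := fun π f =>
    (Function.Bijective.sum_comp ⟨fun a b hab => by
      have := congrArg (relabel π) hab
      simpa only [← relabel_mul, mul_inv_cancel, relabel_one] using this,
      fun b => ⟨relabel π b, by rw [← relabel_mul, inv_mul_cancel, relabel_one]⟩⟩ f).symm
  have htotal : ∑ g₁ : AttrGraph n m, ∑ h : AttrGraph n m, ∑ π : Equiv.Perm (Fin n),
      jointProb p q g₁ (relabel π⁻¹ h) = n.factorial := by
    calc _ = ∑ g₁ : AttrGraph n m, ∑ π : Equiv.Perm (Fin n), ∑ h : AttrGraph n m,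
          jointProb p q g₁ (relabel π⁻¹ h) := Finset.sum_congr rfl fun g₁ _ => Finset.sum_comm
      _ = ∑ g₁ : AttrGraph n m, ∑ π : Equiv.Perm (Fin n), ∑ g₂ : AttrGraph n m,
          jointProb p q g₁ g₂ := by
          simp_rw [← hbij]
      _ = n.factorial := by
          simp_rw [Finset.sum_const, ← Finset.smul_sum]
          rw [sum_jointProb_eq_one, Finset.card_univ, Fintype.card_perm, Fintype.card_fin,
            nsmul_eq_mul, mul_one]
  have herr : errorProb p q est = (n.factorial : ℝ)⁻¹ * ∑ g₁ : AttrGraph n m,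
      ∑ h : AttrGraph n m, ∑ π : Equiv.Perm (Fin n),
        jointProb p q g₁ (relabel π⁻¹ h) * (if est g₁ h = π then 0 else 1) := by
    calc errorProb p q est = ∑ π : Equiv.Perm (Fin n), ∑ g₁ : AttrGraph n m, ∑ h : AttrGraph n m,
          (n.factorial : ℝ)⁻¹ *
            (jointProb p q g₁ (relabel π⁻¹ h) * (if est g₁ h = π then 0 else 1)) := by
          refine Finset.sum_congr rfl fun π _ => Finset.sum_congr rfl fun g₁ _ => ?_
          rw [hbij π]
          refine Finset.sum_congr rfl fun h _ => ?_
          rw [← relabel_mul, mul_inv_cancel, relabel_one, mul_assoc]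
      _ = ∑ g₁ : AttrGraph n m, ∑ π : Equiv.Perm (Fin n), ∑ h : AttrGraph n m,
          (n.factorial : ℝ)⁻¹ *
            (jointProb p q g₁ (relabel π⁻¹ h) * (if est g₁ h = π then 0 else 1)) :=
          Finset.sum_comm
      _ = ∑ g₁ : AttrGraph n m, ∑ h : AttrGraph n m, ∑ π : Equiv.Perm (Fin n),
          (n.factorial : ℝ)⁻¹ *
            (jointProb p q g₁ (relabel π⁻¹ h) * (if est g₁ h = π then 0 else 1)) :=
          Finset.sum_congr rfl fun g₁ _ => Finset.sum_comm
      _ = _ := by simp_rw [← Finset.mul_sum]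
  have hriv : (n.factorial : ℝ) * eventProb p q (HasRival (n := n) (m := m) p q) =
      ∑ g₁ : AttrGraph n m, ∑ h : AttrGraph n m, ∑ π : Equiv.Perm (Fin n),
        jointProb p q g₁ (relabel π⁻¹ h) *
          (if HasRival p q g₁ (relabel π⁻¹ h) then 1 else 0) := by
    calc _ = ∑ g₁ : AttrGraph n m, ∑ π : Equiv.Perm (Fin n), ∑ g₂ : AttrGraph n m,
          jointProb p q g₁ g₂ * (if HasRival p q g₁ g₂ then 1 else 0) := by
          simp_rw [Finset.sum_const, ← Finset.smul_sum]
          rw [Finset.card_univ, Fintype.card_perm, Fintype.card_fin, nsmul_eq_mul]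
          rfl
      _ = ∑ g₁ : AttrGraph n m, ∑ π : Equiv.Perm (Fin n), ∑ h : AttrGraph n m,
          jointProb p q g₁ (relabel π⁻¹ h) *
            (if HasRival p q g₁ (relabel π⁻¹ h) then 1 else 0) :=
          Finset.sum_congr rfl fun g₁ _ => Finset.sum_congr rfl fun π _ =>
            hbij π fun g₂ => jointProb p q g₁ g₂ * (if HasRival p q g₁ g₂ then 1 else 0)
      _ = _ := Finset.sum_congr rfl fun g₁ _ => Finset.sum_comm
  have hpt : ∀ g₁ h : AttrGraph n m,
      ∑ π : Equiv.Perm (Fin n), jointProb p q g₁ (relabel π⁻¹ h) *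
          (if HasRival p q g₁ (relabel π⁻¹ h) then 1 else 0) ≤
      ∑ π : Equiv.Perm (Fin n), jointProb p q g₁ (relabel π⁻¹ h) *
          (if est g₁ h = π then 0 else 1) +
        1 / 2 * ∑ π : Equiv.Perm (Fin n), jointProb p q g₁ (relabel π⁻¹ h) := by
    intro g₁ h
    have hJ : ∀ π : Equiv.Perm (Fin n), 0 ≤ jointProb p q g₁ (relabel π⁻¹ h) := fun π =>
      jointProb_nonneg _ _ _ _
    set π₀ := est g₁ h
    rw [← Finset.add_sum_erase _ _ (Finset.mem_univ π₀),
      ← Finset.add_sum_erase _ (fun π => jointProb p q g₁ (relabel π⁻¹ h) *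
          (if π₀ = π then (0 : ℝ) else 1)) (Finset.mem_univ π₀), if_pos rfl, mul_zero, zero_add,
      add_comm]
    refine add_le_add (Finset.sum_le_sum fun π hπ => ?_) ?_
    · rw [if_neg (Finset.ne_of_mem_erase hπ).symm]
      refine mul_le_mul_of_nonneg_left ?_ (hJ π)
      split_ifs <;> norm_num
    · by_cases hr : HasRival p q g₁ (relabel π₀⁻¹ h)
      · rw [if_pos hr, mul_one]
        obtain ⟨τ, hτ, hle⟩ := hr
        have hne : π₀ ≠ π₀ * τ⁻¹ := fun h => hτ (by simpa using h)
        rw [← relabel_mul, show τ * π₀⁻¹ = (π₀ * τ⁻¹)⁻¹ by simp] at hle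
        have h2 := Finset.add_le_sum (s := Finset.univ)
          (f := fun π : Equiv.Perm (Fin n) => jointProb p q g₁ (relabel π⁻¹ h))
          (fun π _ => hJ π) (Finset.mem_univ π₀) (Finset.mem_univ (π₀ * τ⁻¹)) hne
        linarith
      · rw [if_neg hr, mul_zero]
        exact mul_nonneg (by norm_num) (Finset.sum_nonneg fun π _ => hJ π)
  have hsum := Finset.sum_le_sum fun g₁ (_ : g₁ ∈ (Finset.univ : Finset (AttrGraph n m))) =>
    Finset.sum_le_sum fun h (_ : h ∈ (Finset.univ : Finset (AttrGraph n m))) => hpt g₁ h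
  simp_rw [Finset.sum_add_distrib, ← Finset.mul_sum] at hsum
  rw [← hriv, htotal] at hsum
  rw [herr, ← mul_le_mul_iff_right₀ hfac, mul_add, mul_inv_cancel_left₀ hfac.ne']
  linarith

/-- The vertex pair, a user pair or a user-attribute pair, contains a user of `S`. -/
def Meets (S : Finset (Fin n)) : VertexPair n m → Prop
  | Sum.inl e => Touches S e
  | Sum.inr iv => iv.1 ∈ S

/-- No vertex pair that contains a user of `S` is an edge in both graphs. -/
def Isolated (S : Finset (Fin n)) (g₁ g₂ : AttrGraph n m) : Prop :=
  ∀ e, Meets S e → ¬ (g₁ e && g₂ e) = true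

theorem meets_of_movePair_swap_ne {i j : Fin n} {e : VertexPair n m}
    (h : movePair (Equiv.swap i j) e ≠ e) : Meets {i, j} e := by
  by_contra hm
  refine h ?_
  have hs : (Equiv.swap i j).support ⊆ {i, j} := by
    intro k hk
    rw [Equiv.Perm.mem_support] at hk
    by_contra hk'
    simp only [Finset.mem_insert, Finset.mem_singleton, not_or] at hk'
    exact hk (Equiv.swap_apply_of_ne_of_ne hk'.1 hk'.2)
  rcases e with e | ⟨k, v⟩
  · simp only [movePair]
    congr 1
    refine Subtype.ext (map_eq_self_of_not_touches fun ⟨k, hk, hke⟩ => hm ⟨k, hs hk, hke⟩)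
  · simp only [Meets] at hm
    simp only [movePair]
    congr 2
    by_contra hk
    exact hm (hs (Equiv.Perm.mem_support.2 hk))

theorem EdgeLaw.prob_mul_prob_le {L : EdgeLaw} (hL : 0 ≤ L.cov) {a b a' b' : Bool}
    (h : ¬ (a && b) = true) (h' : ¬ (a' && b') = true) :
    L.prob a b * L.prob a' b' ≤ L.prob a b' * L.prob a' b := by
  rw [EdgeLaw.cov_eq] at hL
  cases a <;> cases b <;> cases a' <;> cases b' <;> simp_all [EdgeLaw.prob] <;> linarith

/-- Two users without common edges can be exchanged without loss of likelihood, because the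
edge indicators are positively correlated. -/
theorem hasRival_of_isolated {p q : EdgeLaw} (hp : 0 ≤ p.cov) (hq : 0 ≤ q.cov)
    {g₁ g₂ : AttrGraph n m} {i j : Fin n} (hij : i ≠ j) (hiso : Isolated {i, j} g₁ g₂) :
    HasRival p q g₁ g₂ := by
  refine ⟨Equiv.swap i j, fun h => hij (by simpa using (Equiv.swap_eq_one_iff.1 h)), ?_⟩
  let σ : Equiv.Perm (VertexPair n m) := pairPerm (Equiv.swap i j)
  have hσ : ∀ e, σ (σ e) = e := fun e => by
    simp only [σ, pairPerm_apply, ← movePair_mul, Equiv.swap_mul_self, movePair_one]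
  have hlaw : ∀ e, pairLaw p q (σ e) = pairLaw p q e := by rintro (e | e) <;> rfl
  have hcov : ∀ e : VertexPair n m, 0 ≤ (pairLaw p q e).cov := by
    rintro (e | e)
    exacts [hp, hq]
  have hrel : jointProb p q g₁ (relabel (Equiv.swap i j) g₂)
      = ∏ e, (pairLaw p q e).prob (g₁ e) (g₂ (σ e)) := by
    simp only [jointProb, relabel, Equiv.swap_inv]
    rfl
  have hrel' : ∏ e, (pairLaw p q e).prob (g₁ e) (g₂ (σ e))
      = ∏ e, (pairLaw p q e).prob (g₁ (σ e)) (g₂ e) := by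
    rw [← Equiv.prod_comp σ]
    simp only [hlaw, hσ]
  have horig : jointProb p q g₁ g₂ = ∏ e, (pairLaw p q e).prob (g₁ (σ e)) (g₂ (σ e)) := by
    rw [jointProb, ← Equiv.prod_comp σ]
    simp only [hlaw]
  refine le_of_sq_le_sq ?_ (jointProb_nonneg _ _ _ _)
  calc jointProb p q g₁ g₂ ^ 2 = ∏ e, (pairLaw p q e).prob (g₁ e) (g₂ e) *
        (pairLaw p q e).prob (g₁ (σ e)) (g₂ (σ e)) := by
        rw [sq, Finset.prod_mul_distrib, ← horig]; rfl
    _ ≤ ∏ e, (pairLaw p q e).prob (g₁ e) (g₂ (σ e)) * (pairLaw p q e).prob (g₁ (σ e)) (g₂ e) := by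
        refine Finset.prod_le_prod (fun e _ => mul_nonneg (EdgeLaw.prob_nonneg _ _ _)
          (EdgeLaw.prob_nonneg _ _ _)) fun e _ => ?_
        by_cases he : σ e = e
        · rw [he]
        · exact EdgeLaw.prob_mul_prob_le (hcov e) (hiso e (meets_of_movePair_swap_ne he))
            (hiso (σ e) (meets_of_movePair_swap_ne fun h => he (by
              have : σ (σ e) = σ e := h
              rw [hσ] at this
              exact this.symm)))
    _ = jointProb p q g₁ (relabel (Equiv.swap i j) g₂) ^ 2 := by
        rw [Finset.prod_mul_distrib, ← hrel', ← hrel, sq]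

theorem eventProb_isolated (p q : EdgeLaw) (S : Finset (Fin n)) :
    eventProb p q (fun g₁ g₂ : AttrGraph n m => Isolated S g₁ g₂)
      = (1 - p.r11) ^ touchCount S * (1 - q.r11) ^ (S.card * m) := by
  classical
  have hpt : ∀ g₁ g₂ : AttrGraph n m, jointProb p q g₁ g₂ *
      (if Isolated S g₁ g₂ then (1 : ℝ) else 0) = ∏ e, (pairLaw p q e).prob (g₁ e) (g₂ e) *
        (if Meets S e ∧ (g₁ e && g₂ e) = true then 0 else 1) := by
    intro g₁ g₂
    rw [Finset.prod_mul_distrib, jointProb]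
    congr 1
    by_cases h : Isolated S g₁ g₂
    · rw [if_pos h, Finset.prod_eq_one]
      exact fun e _ => if_neg fun he => h e he.1 he.2
    · rw [if_neg h]
      simp only [Isolated, not_forall, not_not] at h
      obtain ⟨e, he, he'⟩ := h
      symm
      refine Finset.prod_eq_zero (Finset.mem_univ e) ?_
      exact if_pos ⟨he, he'⟩
  simp only [eventProb]
  simp_rw [hpt]
  rw [sum_sum_prod_eq fun e a b => (pairLaw p q e).prob a b *
    (if Meets S e ∧ (a && b) = true then (0 : ℝ) else 1)]
  have h1 : ∀ e : VertexPair n m, ∑ a, ∑ b, (pairLaw p q e).prob a b *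
      (if Meets S e ∧ (a && b) = true then (0 : ℝ) else 1)
      = if Meets S e then 1 - (pairLaw p q e).r11 else 1 := by
    intro e
    have := (pairLaw p q e).sum_eq_one
    by_cases h : Meets S e <;> simp [h, EdgeLaw.prob] <;> linarith
  rw [Finset.prod_congr rfl fun e _ => h1 e, Fintype.prod_sum_type]
  congr 1
  · have h2 : ∀ e : UserPair n, (if Meets S (Sum.inl e : VertexPair n m) then
        1 - (pairLaw p q (Sum.inl e : VertexPair n m)).r11 else 1)
        = if Touches S e then 1 - p.r11 else 1 := fun e => by
      by_cases h : Touches S e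
      · rw [if_pos h]; exact if_pos h
      · rw [if_neg h]; exact if_neg h
    rw [Finset.prod_congr rfl fun e _ => h2 e, ← Finset.prod_filter, Finset.prod_const]
    rfl
  · have h2 : ∀ iv : Fin n × Fin m, (if Meets S (Sum.inr iv : VertexPair n m) then
        1 - (pairLaw p q (Sum.inr iv : VertexPair n m)).r11 else 1)
        = if iv.1 ∈ S then 1 - q.r11 else 1 := fun iv => by
      by_cases h : iv.1 ∈ S
      · rw [if_pos h]; exact if_pos h
      · rw [if_neg h]; exact if_neg h
    rw [Finset.prod_congr rfl fun e _ => h2 e, ← Finset.prod_filter, Finset.prod_const]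
    congr 1
    have : (Finset.univ.filter fun iv : Fin n × Fin m => iv.1 ∈ S)
        = S ×ˢ (Finset.univ : Finset (Fin m)) := by ext; simp
    rw [this, Finset.card_product, Finset.card_univ, Fintype.card_fin]

/-- The second moment method: if events have nearly uncorrelated indicators and their expected
number is at least `10`, two of them occur together with probability at least `3/4`. -/
theorem sum_exists_pair_ge {Ω ι : Type} [Fintype Ω] [Fintype ι] (P : Ω → ℝ) (hP : ∀ ω, 0 ≤ P ω)
    (hP1 : ∑ ω, P ω = 1) (I : ι → Ω → ℝ) (hI : ∀ i ω, I i ω = 0 ∨ I i ω = 1) {μ : ℝ} (hμ : 0 ≤ μ)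
    (hsingle : ∀ i, μ ≤ ∑ ω, P ω * I i ω)
    (hpair : ∀ i j, i ≠ j → ∑ ω, P ω * (I i ω * I j ω) ≤ 17 / 16 * μ ^ 2)
    (hcard : 10 ≤ Fintype.card ι * μ) (A : Ω → ℝ) (hA0 : ∀ ω, 0 ≤ A ω)
    (hA : ∀ i j ω, i ≠ j → I i ω = 1 → I j ω = 1 → A ω = 1) :
    3 / 4 ≤ ∑ ω, P ω * A ω := by
  classical
  let Y : Ω → ℝ := fun ω => ∑ i, I i ω
  set E := ∑ ω, P ω * Y ω with hE
  have hEsum : E = ∑ i, ∑ ω, P ω * I i ω := by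
    rw [hE, Finset.sum_comm]
    exact Finset.sum_congr rfl fun ω _ => Finset.mul_sum _ _ _
  have hEge : Fintype.card ι * μ ≤ E := by
    rw [hEsum, ← nsmul_eq_mul, ← Finset.card_univ]
    exact Finset.card_nsmul_le_sum _ _ _ fun i _ => hsingle i
  have hY2 : ∑ ω, P ω * Y ω ^ 2 ≤ E + 17 / 16 * E ^ 2 := by
    have h1 : ∑ ω, P ω * Y ω ^ 2 = ∑ i, ∑ j, ∑ ω, P ω * (I i ω * I j ω) := by
      calc _ = ∑ ω, ∑ i, ∑ j, P ω * (I i ω * I j ω) := by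
            refine Finset.sum_congr rfl fun ω _ => ?_
            rw [sq, Finset.sum_mul_sum, Finset.mul_sum]
            exact Finset.sum_congr rfl fun i _ => Finset.mul_sum _ _ _
        _ = _ := by
            rw [Finset.sum_comm]
            exact Finset.sum_congr rfl fun i _ => Finset.sum_comm
    have h2 : ∀ i, ∑ j, ∑ ω, P ω * (I i ω * I j ω) ≤
        ∑ ω, P ω * I i ω + Fintype.card ι * (17 / 16 * μ ^ 2) := by
      intro i
      rw [← Finset.add_sum_erase _ _ (Finset.mem_univ i)]
      refine add_le_add (le_of_eq (Finset.sum_congr rfl fun ω _ => ?_)) ?_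
      · rcases hI i ω with h | h <;> simp [h]
      · refine (Finset.sum_le_card_nsmul _ _ _ fun j hj =>
          hpair i j (Finset.ne_of_mem_erase hj).symm).trans ?_
        rw [nsmul_eq_mul]
        have hc : (((Finset.univ : Finset ι).erase i).card : ℝ) ≤ Fintype.card ι := by
          exact_mod_cast (Finset.card_erase_le).trans_eq Finset.card_univ
        gcongr
    rw [h1]
    refine (Finset.sum_le_sum fun i _ => h2 i).trans ?_
    rw [Finset.sum_add_distrib, ← hEsum, Finset.sum_const, Finset.card_univ, nsmul_eq_mul]
    have h3 : (Fintype.card ι * μ) ^ 2 ≤ E ^ 2 :=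
      pow_le_pow_left₀ (mul_nonneg (Nat.cast_nonneg _) hμ) hEge 2
    linarith
  have hE10 : 10 ≤ E := hcard.trans hEge
  have hYn : ∀ ω, A ω = 1 ∨ (0 ≤ Y ω ∧ Y ω ≤ 1) := by
    intro ω
    by_cases h : ∃ i j, i ≠ j ∧ I i ω = 1 ∧ I j ω = 1
    · obtain ⟨i, j, hij, hi, hj⟩ := h
      exact Or.inl (hA i j ω hij hi hj)
    · push Not at h
      refine Or.inr ⟨Finset.sum_nonneg fun i _ => by rcases hI i ω with h | h <;> simp [h], ?_⟩
      by_cases h1 : ∃ i, I i ω = 1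
      · obtain ⟨i, hi⟩ := h1
        refine le_of_eq ?_
        simp only [Y]
        rw [Finset.sum_eq_single i (fun j _ hji =>
          (hI j ω).resolve_right (h i j hji.symm hi)) (by simp), hi]
      · push Not at h1
        simp only [Y]
        rw [Finset.sum_eq_zero fun i _ => (hI i ω).resolve_right (h1 i)]
        norm_num
  -- Chebyshev: where no two events occur, the count is at most `1`, so at least `E - 1` below `E`
  have hpt : ∀ ω, (E - 1) ^ 2 * (P ω * (1 - A ω)) ≤ P ω * Y ω ^ 2 - 2 * E * (P ω * Y ω)
      + E ^ 2 * P ω := by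
    intro ω
    have h1 : (E - 1) ^ 2 * (1 - A ω) ≤ (Y ω - E) ^ 2 := by
      rcases hYn ω with h | ⟨h0, h1⟩
      · rw [h, sub_self, mul_zero]; positivity
      · have : (E - 1) ^ 2 ≤ (E - Y ω) ^ 2 := by
          apply pow_le_pow_left₀ <;> linarith
        nlinarith [hA0 ω, sq_nonneg (E - 1)]
    nlinarith [mul_le_mul_of_nonneg_left h1 (hP ω)]
  have hsum := Finset.sum_le_sum fun ω (_ : ω ∈ (Finset.univ : Finset Ω)) => hpt ω
  rw [← Finset.mul_sum, Finset.sum_add_distrib, Finset.sum_sub_distrib, ← Finset.mul_sum,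
    ← Finset.mul_sum, hP1, ← hE] at hsum
  simp_rw [mul_sub, mul_one] at hsum
  rw [Finset.sum_sub_distrib, hP1] at hsum
  by_contra! hlt
  nlinarith [mul_pos (show 0 < (E - 1) ^ 2 by nlinarith) (show 0 < 3 / 4 - ∑ ω, P ω * A ω by linarith)]

open Classical in
theorem eventProb_eq_sum_prod (p q : EdgeLaw) (A : AttrGraph n m → AttrGraph n m → Prop) :
    eventProb p q A = ∑ ω : AttrGraph n m × AttrGraph n m, jointProb p q ω.1 ω.2 *
      (if A ω.1 ω.2 then (1 : ℝ) else 0) := by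
  rw [eventProb, Fintype.sum_prod_type]

theorem eventProb_isolated_singleton_ge (p q : EdgeLaw) (i : Fin n) :
    (1 - p.r11) ^ n * (1 - q.r11) ^ m ≤
      eventProb p q fun g₁ g₂ : AttrGraph n m => Isolated {i} g₁ g₂ := by
  rw [eventProb_isolated, Finset.card_singleton, one_mul]
  have h1 : touchCount ({i} : Finset (Fin n)) ≤ n := by
    have := touchCount_le ({i} : Finset (Fin n))
    rw [Finset.card_singleton, Nat.cast_one, one_mul] at this
    exact_mod_cast this
  exact mul_le_mul_of_nonneg_right (pow_le_pow_of_le_one (by linarith [p.r11_le_one])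
    (by linarith [p.r11_nonneg]) h1) (pow_nonneg (by linarith [q.r11_le_one]) _)

theorem eventProb_isolated_pair_le {p : EdgeLaw} (q : EdgeLaw) (hp64 : p.r11 ≤ 1 / 64)
    {i j : Fin n} (hij : i ≠ j) :
    eventProb p q (fun g₁ g₂ : AttrGraph n m => Isolated {i, j} g₁ g₂) ≤
      17 / 16 * ((1 - p.r11) ^ n * (1 - q.r11) ^ m) ^ 2 := by
  have hq1 : 0 ≤ 1 - q.r11 := by linarith [q.r11_le_one]
  have hp1 : 63 / 64 ≤ 1 - p.r11 := by linarith
  have hp1' : 1 - p.r11 ≤ 1 := by linarith [p.r11_nonneg]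
  rw [eventProb_isolated, Finset.card_pair hij]
  generalize 1 - p.r11 = a at *
  generalize 1 - q.r11 = b at *
  have ha : 0 ≤ a := by linarith
  have h2 : 2 * n ≤ touchCount ({i, j} : Finset (Fin n)) + 3 := by
    have := le_touchCount ({i, j} : Finset (Fin n))
    rw [Finset.card_pair hij] at this
    have h3 : (2 * n : ℝ) ≤ touchCount ({i, j} : Finset (Fin n)) + 3 := by
      push_cast at this; linarith
    exact_mod_cast h3
  generalize touchCount ({i, j} : Finset (Fin n)) = T at *
  have h4 : a ^ T ≤ 17 / 16 * a ^ (2 * n) := by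
    have h5 : a ^ (T + 3) ≤ a ^ (2 * n) := pow_le_pow_of_le_one ha hp1' h2
    have h6 : 16 / 17 ≤ a ^ 3 :=
      le_trans (by norm_num) (pow_le_pow_left₀ (by norm_num) hp1 3)
    have h7 : a ^ T * (16 / 17) ≤ a ^ T * a ^ 3 :=
      mul_le_mul_of_nonneg_left h6 (pow_nonneg ha T)
    rw [pow_add] at h5
    linarith
  calc a ^ T * b ^ (2 * m) ≤ 17 / 16 * a ^ (2 * n) * b ^ (2 * m) :=
        mul_le_mul_of_nonneg_right h4 (pow_nonneg hq1 _)
    _ = 17 / 16 * (a ^ n * b ^ m) ^ 2 := by ring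

theorem Isolated.pair {i j : Fin n} {g₁ g₂ : AttrGraph n m} (hi : Isolated {i} g₁ g₂)
    (hj : Isolated {j} g₁ g₂) : Isolated {i, j} g₁ g₂ := by
  rintro (e | iv) he
  · obtain ⟨k, hk, hke⟩ := he
    rcases Finset.mem_insert.1 hk with rfl | hk
    · exact hi _ ⟨k, by simp, hke⟩
    · exact hj _ ⟨k, hk, hke⟩
  · rcases Finset.mem_insert.1 he with h | h
    · exact hi _ (Finset.mem_singleton.2 h)
    · exact hj _ h

theorem eventProb_hasRival_ge {p q : EdgeLaw} (hp : 0 ≤ p.cov) (hq : 0 ≤ q.cov)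
    (hp64 : p.r11 ≤ 1 / 64) (hE : 10 ≤ n * ((1 - p.r11) ^ n * (1 - q.r11) ^ m)) :
    3 / 4 ≤ eventProb p q (HasRival (n := n) (m := m) p q) := by
  classical
  have hμ : 0 ≤ (1 - p.r11) ^ n * (1 - q.r11) ^ m :=
    mul_nonneg (pow_nonneg (by linarith [p.r11_le_one]) _)
      (pow_nonneg (by linarith [q.r11_le_one]) _)
  rw [eventProb_eq_sum_prod]
  refine sum_exists_pair_ge (Ω := AttrGraph n m × AttrGraph n m) (ι := Fin n)
    (fun ω => jointProb p q ω.1 ω.2)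
    (fun ω => jointProb_nonneg _ _ _ _) (by rw [Fintype.sum_prod_type, sum_jointProb_eq_one])
    (fun i ω => if Isolated {i} ω.1 ω.2 then 1 else 0) (fun i ω => ?_) hμ (fun i => ?_)
    (fun i j hij => ?_) (by rwa [Fintype.card_fin])
    (fun ω => if HasRival p q ω.1 ω.2 then 1 else 0) (fun ω => ?_) (fun i j ω hij hi hj => ?_)
  · by_cases h : Isolated {i} ω.1 ω.2
    · exact Or.inr (if_pos h)
    · exact Or.inl (if_neg h)
  · have h := eventProb_isolated_singleton_ge (m := m) p q i
    rwa [eventProb_eq_sum_prod] at h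
  · refine le_trans ?_ (eventProb_isolated_pair_le (m := m) q hp64 hij)
    rw [eventProb_eq_sum_prod]
    refine Finset.sum_le_sum fun ω _ => mul_le_mul_of_nonneg_left ?_ (jointProb_nonneg _ _ _ _)
    by_cases hi : Isolated {i} ω.1 ω.2
    · by_cases hj : Isolated {j} ω.1 ω.2
      · rw [if_pos hi, if_pos hj, if_pos (hi.pair hj), mul_one]
      · rw [if_neg hj, mul_zero]; split_ifs <;> norm_num
    · rw [if_neg hi, zero_mul]; split_ifs <;> norm_num
  · split_ifs <;> norm_num
  · have hi' : Isolated {i} ω.1 ω.2 := by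
      by_contra h
      rw [if_neg h] at hi
      exact zero_ne_one hi
    have hj' : Isolated {j} ω.1 ω.2 := by
      by_contra h
      rw [if_neg h] at hj
      exact zero_ne_one hj
    exact if_pos (hasRival_of_isolated hp hq hij (hi'.pair hj'))

theorem exp_neg_le_one_sub {r : ℝ} (h1 : r ≤ 1 / 2) :
    Real.exp (-(r + 2 * r ^ 2)) ≤ 1 - r := by
  rw [Real.exp_neg, inv_le_comm₀ (Real.exp_pos _) (by linarith)]
  refine le_trans ?_ (Real.add_one_le_exp _)
  rw [inv_le_iff_one_le_mul₀ (by linarith)]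
  nlinarith [mul_nonneg (sq_nonneg r) (by linarith : 0 ≤ 1 - 2 * r)]

/-- If `n * p11 + m * q11` stays below `log n` by a diverging amount, every estimator errs with
probability at least `1 / 4` for all large `n`. -/
theorem not_achievable_of_tendsto_atBot {m : ℕ → ℕ} {p q : ℕ → EdgeLaw}
    (hp : PositivelyCorrelated p) (hq : PositivelyCorrelated q)
    (hm : (fun n : ℕ => Real.log n ^ 3) =O[atTop] (fun n : ℕ => (m n : ℝ)))
    (ht : Tendsto (fun n : ℕ => n * (p n).r11 + m n * (q n).r11 - Real.log n) atTop atBot) :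
    ¬ ExactAlignmentAchievable m p q := by
  rintro ⟨est, hest⟩
  obtain ⟨c, hc, hmc⟩ := hm.exists_pos
  have hev : ∀ᶠ n : ℕ in atTop, 1 / 4 ≤ errorProb (p n) (q n) (est n) := by
    filter_upwards [hmc.bound, ht.eventually_le_atBot (-20), eventually_ge_atTop 1,
      eventually_mul_log_pow_le 64 1, eventually_mul_log_pow_le 1 2,
      tendsto_log_natCast_atTop.eventually_ge_atTop (2 * c + 1)]
      with n hmn htn hn1 hl1 hl2 hlog
    have hn0 : (0 : ℝ) < n := by exact_mod_cast hn1
    have hlog1 : 1 ≤ Real.log n := by linarith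
    have hm0 : (0 : ℝ) ≤ m n := Nat.cast_nonneg _
    rw [Real.norm_eq_abs, Real.norm_eq_abs, abs_of_nonneg (by positivity), Nat.abs_cast] at hmn
    have hmpos : (0 : ℝ) < m n := by
      have : 0 < Real.log n ^ 3 := by positivity
      by_contra! h
      nlinarith
    set a := (p n).r11
    set b := (q n).r11
    have ha0 : 0 ≤ a := (p n).r11_nonneg
    have hb0 : 0 ≤ b := (q n).r11_nonneg
    have hna : 0 ≤ n * a := by positivity
    have hmb : 0 ≤ m n * b := by positivity
    have hnal : n * a ≤ Real.log n := by linarith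
    have hmbl : m n * b ≤ Real.log n := by linarith
    have ha64 : a ≤ 1 / 64 := by
      refine le_of_mul_le_mul_left ?_ hn0
      linarith
    -- `2 log n ^ 2 ≤ m` because `m` is of order at least `log n ^ 3`
    have hlm : 2 * Real.log n ^ 2 ≤ m n := by
      refine le_of_mul_le_mul_left ?_ hc
      nlinarith [sq_nonneg (Real.log n)]
    have hb2 : b ≤ 1 / 2 := by
      refine le_of_mul_le_mul_left ?_ hmpos
      nlinarith
    have hna2 : n * a ^ 2 ≤ 1 := by
      refine le_of_mul_le_mul_left ?_ hn0
      calc n * (n * a ^ 2) = (n * a) ^ 2 := by ring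
        _ ≤ Real.log n ^ 2 := by gcongr
        _ ≤ n * 1 := by linarith
    have hmb2 : m n * b ^ 2 ≤ 1 := by
      refine le_of_mul_le_mul_left ?_ hmpos
      calc m n * (m n * b ^ 2) = (m n * b) ^ 2 := by ring
        _ ≤ Real.log n ^ 2 := by gcongr
        _ ≤ m n * 1 := by nlinarith [sq_nonneg (Real.log n)]
    have hE : 10 ≤ n * ((1 - a) ^ n * (1 - b) ^ m n) := by
      calc (10 : ℝ) ≤ Real.exp 9 := by linarith [Real.add_one_le_exp (9 : ℝ)]
        _ ≤ Real.exp (Real.log n + (n * -(a + 2 * a ^ 2) + m n * -(b + 2 * b ^ 2))) := by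
            rw [Real.exp_le_exp]; linarith
        _ = n * (Real.exp (-(a + 2 * a ^ 2)) ^ n * Real.exp (-(b + 2 * b ^ 2)) ^ m n) := by
            rw [Real.exp_add, Real.exp_log hn0, Real.exp_add, Real.exp_nat_mul, Real.exp_nat_mul]
        _ ≤ _ := by
            refine mul_le_mul_of_nonneg_left (mul_le_mul
              (pow_le_pow_left₀ (Real.exp_pos _).le (exp_neg_le_one_sub (by linarith)) n)
              (pow_le_pow_left₀ (Real.exp_pos _).le (exp_neg_le_one_sub hb2) (m n))
              (by positivity) (pow_nonneg (by linarith) n)) hn0.le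
    have h1 := eventProb_hasRival_ge (n := n) (m := m n)
      (EdgeLaw.cov_pos_of_corr_pos (hp n)).le (EdgeLaw.cov_pos_of_corr_pos (hq n)).le ha64 hE
    have h2 := eventProb_hasRival_le_errorProb_add (p n) (q n) (est n)
    linarith
  have := ge_of_tendsto hest hev
  norm_num at this

/-! ### From the gap of the attribute edges to `q11` -/

theorem exists_pos_eventually_le_of_isTheta_one {f : ℕ → ℝ} (hf : ∀ n, 0 ≤ f n)
    (h : f =Θ[atTop] fun _ => (1 : ℝ)) : ∃ δ > 0, ∀ᶠ n in atTop, δ ≤ f n := by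
  obtain ⟨c, hc, hb⟩ := h.2.exists_pos
  refine ⟨c⁻¹, inv_pos.2 hc, ?_⟩
  filter_upwards [hb.bound] with n hn
  rw [norm_one, Real.norm_eq_abs, abs_of_nonneg (hf n)] at hn
  rwa [inv_le_iff_one_le_mul₀' hc]

theorem NonEdgeAndCorrTheta.exists_atLeast {p : ℕ → EdgeLaw} (hpos : PositivelyCorrelated p)
    (h : NonEdgeAndCorrTheta p) : ∃ δ > 0, ∀ᶠ n in atTop, (p n).AtLeast δ := by
  obtain ⟨δ₁, h₁, e₁⟩ := exists_pos_eventually_le_of_isTheta_one (fun n => by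
    rw [EdgeLaw.edge₁]
    linarith [(p n).sum_eq_one, (p n).r01_nonneg, (p n).r00_nonneg]) h.1
  obtain ⟨δ₂, h₂, e₂⟩ := exists_pos_eventually_le_of_isTheta_one (fun n => by
    rw [EdgeLaw.edge₂]
    linarith [(p n).sum_eq_one, (p n).r10_nonneg, (p n).r00_nonneg]) h.2.1
  obtain ⟨δ₃, h₃, e₃⟩ := exists_pos_eventually_le_of_isTheta_one (fun n => (hpos n).le) h.2.2
  refine ⟨min δ₁ (min δ₂ δ₃), lt_min h₁ (lt_min h₂ h₃), ?_⟩
  filter_upwards [e₁, e₂, e₃] with n a₁ a₂ a₃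
  exact ⟨(min_le_left _ _).trans a₁, ((min_le_right _ _).trans (min_le_left _ _)).trans a₂,
    ((min_le_right _ _).trans (min_le_right _ _)).trans a₃⟩

/-- When there are at least of order `(log n)³` attributes, the gap of an attribute edge can be
replaced by `q11`: either `m * q11` is so large that the gaps add up to `2 log n`, or `q11` is so
small that the error term `m * q11 ^ (3 / 2)` is bounded. -/
theorem tendsto_gap_of_log_pow_isBigO {m : ℕ → ℕ} {p q : ℕ → EdgeLaw} {δ : ℝ} (hδ : 0 < δ)
    (hq : ∀ᶠ n in atTop, (q n).AtLeast δ)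
    (hm : (fun n : ℕ => Real.log n ^ 3) =O[atTop] (fun n : ℕ => (m n : ℝ)))
    (ht : Tendsto (fun n : ℕ => n * (p n).r11 + m n * (q n).r11 - Real.log n) atTop atTop) :
    Tendsto (fun n : ℕ => n * (p n).r11 + m n * (q n).gap - Real.log n) atTop atTop := by
  obtain ⟨c, hc, hmc⟩ := hm.exists_pos
  have hδ4 : 0 < δ ^ 4 / 4 := by positivity
  set K := 2 / (δ ^ 4 / 4) with hK
  set C := 1 + 4 * (δ ^ 4)⁻¹ with hC
  have hC0 : 0 < C := by positivity
  have hK0 : 0 < K := by positivity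
  rw [tendsto_atTop]
  intro B
  filter_upwards [hmc.bound, hq, ht.eventually_ge_atTop (B + C * (1 + K ^ 3 * c)),
    tendsto_log_natCast_atTop.eventually_ge_atTop (max B 1)] with n hmn hqn htn hlog
  have hlogB : B ≤ Real.log n := (le_max_left _ _).trans hlog
  have hlog1 : 1 ≤ Real.log n := (le_max_right _ _).trans hlog
  rw [Real.norm_eq_abs, Real.norm_eq_abs, abs_of_nonneg (by positivity), Nat.abs_cast] at hmn
  have hm0 : (0 : ℝ) ≤ m n := Nat.cast_nonneg _
  have hb0 := (q n).r11_nonneg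
  have hx0 : 0 ≤ n * (p n).r11 := mul_nonneg (Nat.cast_nonneg _) (p n).r11_nonneg
  by_cases hlarge : K * Real.log n ≤ m n * (q n).r11
  · have h1 : m n * (δ ^ 4 / 4 * (q n).r11) ≤ m n * (q n).gap := by
      gcongr
      exact hqn.gap_ge hδ
    have h2 : 2 * Real.log n ≤ δ ^ 4 / 4 * (m n * (q n).r11) := by
      calc 2 * Real.log n = δ ^ 4 / 4 * (K * Real.log n) := by rw [hK]; field_simp
        _ ≤ _ := by gcongr
    linarith
  · have hmpos : (0 : ℝ) < m n := by
      have : 0 < Real.log n ^ 3 := by positivity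
      by_contra! h
      nlinarith
    have h1 : m n * ((q n).r11 - C * ((q n).r11 * √(q n).r11)) ≤ m n * (q n).gap := by
      gcongr
      exact hqn.gap_ge_sub hδ
    have h2 : (m n * ((q n).r11 * √(q n).r11)) ^ 2 ≤ K ^ 3 * c := by
      refine le_of_mul_le_mul_left ?_ hmpos
      calc m n * (m n * ((q n).r11 * √(q n).r11)) ^ 2
          = m n * (m n ^ 2 * ((q n).r11 ^ 2 * √(q n).r11 ^ 2)) := by ring
        _ = (m n * (q n).r11) ^ 3 := by rw [Real.sq_sqrt hb0]; ring
        _ ≤ (K * Real.log n) ^ 3 := by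
            have := (not_le.1 hlarge).le
            gcongr
        _ = K ^ 3 * Real.log n ^ 3 := mul_pow _ _ _
        _ ≤ K ^ 3 * (c * m n) := by gcongr
        _ = m n * (K ^ 3 * c) := by ring
    have h3 : m n * ((q n).r11 * √(q n).r11) ≤ 1 + K ^ 3 * c := by
      nlinarith [sq_nonneg (m n * ((q n).r11 * √(q n).r11) - 1)]
    have h4 := mul_le_mul_of_nonneg_left h3 hC0.le
    linarith

theorem rpow_three_halves {x : ℝ} (hx : 0 < x) : x ^ (3 / 2 : ℝ) = x * √x := by
  rw [show (3 / 2 : ℝ) = 1 + 1 / 2 by norm_num, Real.rpow_add hx, Real.rpow_one,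
    Real.sqrt_eq_rpow]

end AttributedAlignment

theorem corollary1 :
    -- the regime `m = Ω((log n)³)`: achievability, and the matching converse
    (∀ (m : ℕ → ℕ) (p q : ℕ → EdgeLaw),
      PositivelyCorrelated p → PositivelyCorrelated q →
      NonEdgeAndCorrTheta p → NonEdgeAndCorrTheta q →
      (fun n : ℕ => Real.log n ^ 3) =O[atTop] (fun n : ℕ => (m n : ℝ)) →
      (Tendsto (fun n : ℕ => n * (p n).r11 + m n * (q n).r11 - Real.log n) atTop atTop →
        ExactAlignmentAchievable m p q) ∧
      (Tendsto (fun n : ℕ => n * (p n).r11 + m n * (q n).r11 - Real.log n) atTop atBot →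
        ¬ ExactAlignmentAchievable m p q)) ∧
    -- the regime `m = o((log n)³)`: the constant of the `O` term depends only on the constants
    -- in the conditions on the attribute edges
    (∀ δ : ℝ, 0 < δ → ∃ C : ℝ, 0 < C ∧
      ∀ (m : ℕ → ℕ) (p q : ℕ → EdgeLaw),
        PositivelyCorrelated p → PositivelyCorrelated q →
        NonEdgeAndCorrTheta p → NonEdgeAndCorrAtLeast δ q →
        (fun n : ℕ => (m n : ℝ)) =o[atTop] (fun n : ℕ => Real.log n ^ 3) →
        Tendsto (fun n : ℕ => n * (p n).r11 + m n * (q n).r11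
          - C * (m n * (q n).r11 ^ (3 / 2 : ℝ)) - Real.log n) atTop atTop →
        ExactAlignmentAchievable m p q) := by
  refine ⟨fun m p q hp hq hpΘ hqΘ hm => ⟨fun ht => ?_, fun ht => ?_⟩, fun δ hδ => ?_⟩
  · obtain ⟨δ, hδ, hpδ⟩ := hpΘ.exists_atLeast hp
    obtain ⟨δ', hδ', hqδ⟩ := hqΘ.exists_atLeast hq
    exact achievable_of_tendsto_gap hδ hpδ (tendsto_gap_of_log_pow_isBigO hδ' hqδ hm ht)
  · exact not_achievable_of_tendsto_atBot hp hq hm ht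
  · refine ⟨1 + 4 * (δ ^ 4)⁻¹, by positivity, fun m p q hp hq hpΘ hqδ _ ht => ?_⟩
    obtain ⟨δ', hδ', hpδ⟩ := hpΘ.exists_atLeast hp
    refine achievable_of_tendsto_gap hδ' hpδ (tendsto_atTop_mono' _ ?_ ht)
    filter_upwards [hqδ] with n hqn
    have h1 := mul_le_mul_of_nonneg_left (EdgeLaw.AtLeast.gap_ge_sub hδ hqn)
      (Nat.cast_nonneg (α := ℝ) (m n))
    rw [rpow_three_halves (EdgeLaw.r11_pos_of_corr_pos (hq n))]
    linarith
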